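/- Let $A=\{0,1,2\}$, let $X=A^{\mathbb N}$ with the product topology and the shift $(Tx)_i=x_{i+1}$; for a word $u$ write $[u]\subseteq X$ for its cylinder, $x\langle n\rangle=x_0\dots x_{n-1}$ for $x\in X$, and $u'$ for the word obtained from $u$ by exchanging the letters $1$ and $2$. Let $\omega_n=\max\{k:2^k\mid n\}$ for $n\ge 1$. Let $(b_n)_{n\ge1}$ be a sequence of powers of $2$ with $$\lim_{n\to\infty}\frac{b_{n+1}}{2^{\prod_{i=1}^n b_i}}=\infty .$$ Put $a_0=1$, $\mathcal A_0=\{1,2\}$, $a_{k+1}=2b_{k+1}a_k+2b_{k+1}-1$, and let $\mathcal A_{k+1}$ be the set of all words (of length $a_{k+1}$) $$u(1)0^{\omega_1}u(2)0^{\omega_2}\cdots u(m)0^{\omega_m}\,u(1)'0^{\omega_{m+1}}u(2)'0^{\omega_{m+2}}\cdots u(m)'0^{\omega_{2m}},\qquad m=b_{k+1},\ u(i)\in\mathcal A_k .$$ There is exactly one Borel probability measure $\nu$ on $X$ such that for all $k\ge0$ and $u\in A^{a_k}$ one has $\nu([u])=1/\#\mathcal A_k$ if $u\in\mathcal A_k$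 and $\nu([u])=0$ otherwise. The averages $\frac1n\sum_{i=0}^{n-1}T^i\nu$ (where $T^i\nu=\nu\circ T^{-i}$) converge weakly to a $T$-invariant probability measure $\mu$. For $B\subseteq X$ measurable with $\mu(B)>0$ let $\tau_B(y)=\min\{k\ge1:T^ky\in B\}\in\mathbb N\cup\{\infty\}$, $F_B(t)=\mu\{y\in X:\mu(B)\tau_B(y)\le t\}$ and $\tilde F_B(t)=\mu(\{y\in B:\mu(B)\tau_B(y)\le t\})/\mu(B)$. Let $X'$ be the set of points of the support of $\mu$ that are not eventually equal to $0$. Then $\mu(X')=1$, and for every $x\in X'$ and every $t>0$, $$\lim_{n\to\infty}\tilde F_{[x\langle n\rangle]}(t)=\lim_{n\to\infty}F_{[x\langle n\rangle]}(t)=1-e^{-t}.$$ -/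

import Mathlib

open Filter Topology MeasureTheory

noncomputable section

namespace ExpReturn

/-- The one-sided sequences over the alphabet `A = {0, 1, 2}`, with the product topology and the
product sigma-algebra (generated by the cylinders). -/
abbrev Point : Type := ℕ → Fin 3

/-- The shift `(T x)_i = x_{i+1}`. -/
def shift (x : Point) : Point := fun i => x (i + 1)

/-- The cylinder `[u]` of a finite word `u`. The cylinder `[x⟨n⟩]` around a point `x` is
`PiNat.cylinder x n`. -/
def wordCylinder (u : List (Fin 3)) : Set Point :=
  {y | ∀ (i : ℕ) (h : i < u.length), y i = u[i]}

/-- The ruler sequence: `omega n` is the largest `k` such that `2 ^ k` divides `n`, for `n ≥ 1`. -/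
def omega (n : ℕ) : ℕ := padicValNat 2 n

/-- The negation of a word: it exchanges the letters `1` and `2` and fixes `0`. -/
def negWord (u : List (Fin 3)) : List (Fin 3) := u.map (Equiv.swap (1 : Fin 3) 2)

/-- `v(1) 0^{ω_1} v(2) 0^{ω_2} ⋯ v(m) 0^{ω_m}` for a list `[v(1), …, v(m)]` of words. -/
def withGaps (vs : List (List (Fin 3))) : List (Fin 3) :=
  (vs.mapIdx fun i v => v ++ List.replicate (omega (i + 1)) 0).flatten

/-- The lengths `a_0 = 1`, `a_{k+1} = 2 b_{k+1} a_k + 2 b_{k+1} - 1` (where every `b_{k+1} ≥ 1`).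
The value `b 0` is never used. -/
def blockLength (b : ℕ → ℕ) : ℕ → ℕ
  | 0 => 1
  | k + 1 => 2 * b (k + 1) * blockLength b k + 2 * b (k + 1) - 1

/-- The families of words: `A_0 = {1, 2}`, and `A_{k+1}` consists of the words
`u(1) 0^{ω_1} ⋯ u(m) 0^{ω_m} u(1)' 0^{ω_{m+1}} ⋯ u(m)' 0^{ω_{2m}}` with `m = b_{k+1}` and
`u(1), …, u(m) ∈ A_k`. -/
def blocks (b : ℕ → ℕ) : ℕ → Set (List (Fin 3))
  | 0 => {[1], [2]}
  | k + 1 => {w | ∃ us : List (List (Fin 3)), us.length = b (k + 1) ∧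
      (∀ u ∈ us, u ∈ blocks b k) ∧ w = withGaps (us ++ us.map negWord)}

/-- The defining property of the non-stationary measure `ν`: for every `k` and every word `u` of
length `a_k`, `ν [u]` is `1 / #A_k` if `u ∈ A_k`, and `0` otherwise. -/
def IsBlockMeasure (b : ℕ → ℕ) (ν : ProbabilityMeasure Point) : Prop :=
  ∀ (k : ℕ) (u : List (Fin 3)), u.length = blockLength b k →
    (u ∈ blocks b k → (ν : Measure Point) (wordCylinder u) = 1 / ((blocks b k).ncard : ENNReal)) ∧
    (u ∉ blocks b k → (ν : Measure Point) (wordCylinder u) = 0)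

theorem measurable_shift : Measurable shift :=
  measurable_pi_lambda _ fun i => measurable_pi_apply (i + 1)

/-- The Cesàro averages `(1 / (n + 1)) ∑_{i = 0}^{n} T^i ν`, where `T^i ν` is the image of `ν`
under the `i`-th iterate of the shift. -/
def cesaro (ν : ProbabilityMeasure Point) (n : ℕ) : ProbabilityMeasure Point :=
  ⟨((n + 1 : ℕ) : ENNReal)⁻¹ •
      ∑ i ∈ Finset.range (n + 1), (ν : Measure Point).map (shift^[i]), by
    constructor
    have h : ∀ i : ℕ, ((ν : Measure Point).map (shift^[i])) Set.univ = 1 := fun i => by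
      rw [Measure.map_apply (measurable_shift.iterate i) MeasurableSet.univ]
      simp
    rw [Measure.smul_apply, Measure.finsetSum_apply, Finset.sum_congr rfl fun i _ => h i]
    simp only [Finset.sum_const, Finset.card_range, nsmul_eq_mul, mul_one, smul_eq_mul]
    exact ENNReal.inv_mul_cancel (by simp) (ENNReal.natCast_ne_top _)⟩

/-- `τ_B(y) = min {k ≥ 1 : T^k y ∈ B}`, equal to `∞` if there is no such `k`. -/
def hittingTime (B : Set Point) (y : Point) : ℕ∞ :=
  ⨅ (k : ℕ) (_ : 1 ≤ k ∧ shift^[k] y ∈ B), (k : ℕ∞)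

/-- The set of the points `y` with `μ(B) τ_B(y) ≤ t`. -/
def hitsBefore (μ : Measure Point) (B : Set Point) (t : ℝ) : Set Point :=
  {y | μ B * (hittingTime B y : ENNReal) ≤ ENNReal.ofReal t}

/-- The distribution function `F_B` of the rescaled hitting time. -/
def hittingLaw (μ : Measure Point) (B : Set Point) (t : ℝ) : ℝ :=
  μ.real (hitsBefore μ B t)

/-- The distribution function `F̃_B` of the rescaled return time, i.e. with respect to the
conditional measure `μ_B`. -/
def returnLaw (μ : Measure Point) (B : Set Point) (t : ℝ) : ℝ :=
  (ProbabilityTheory.cond μ B).real (B ∩ hitsBefore μ B t)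

/-- `X'`: the topological support of `μ` without the points that are eventually `0`, that is
without the preimages of the zero sequence under the iterates of the shift. -/
def goodPoints (μ : Measure Point) : Set Point :=
  μ.support \ ⋃ i : ℕ, shift^[i] ⁻¹' {fun _ => 0}

end ExpReturn

end

/-!
Every sequence in the support of `ν` consists of nonzero letters with the numbers `0, 1, 2, …`, and
the letter number `n ≥ 1` is preceded by exactly `omega n` zeros. This holds since the lengths `b_k`
are powers of `2`, so that the zeros at the end of a word of one family and the zeros that the next
family inserts after it add up to a value of the ruler sequence. The letter number `n` stands at the
position `letterPos n`, which is additive over binary blocks (`letterPos_mul_pow_add`) and close to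
`2 n`. The negations are controlled by certain binary digits, the flip positions: the sign of the
letter number `n` is a fair coin, indexed by the binary digits of `n` outside the flip positions
(`key`), reversed once for each digit `1` of `n` at a flip position (`par`). Hence `ν` is the image
of a product of fair coins under the map `point` (`isBlockMeasure_pointLaw`,
`eq_of_isBlockMeasure`).

The Cesàro averages converge since all blocks of `2 ^ R` letters have the same law
(`measurePreserving_move`, `freq_block`): for a set `V` that depends on finitely many letters, the
expected number of occurrences of `V` in one block bounds the averages of `V` and of its complement
from below, and any two limit points agree. The space of probability measures is compact.

Let `B` be a cylinder with a nonzero letter. The zeros in its word determine the numbers of the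
letters modulo a power `2 ^ R`, and the word lies in a single block of `2 ^ R` letters
(`exists_window`). So `B` occurs exactly once in each block whose coins match the word; this has a
probability `p`. The coins of different blocks are independent, except that there are copies, and
reversed copies, of blocks. As no block matches both a word and its reversal, a pair of a block and
its reversed copy stays without a match with the probability `1 - 2 p`, not larger than the
`(1 - p) ^ 2` of two independent blocks, but equal to it up to second order. Copies without a
reversal differ in two digits at flip positions, hence they are far apart, and the growth of `b`
makes this distance large compared with `1 / p` (`window_asymptotics`). Therefore, the probability
that a return to `B` takes more than `m` blocks is asymptotically at least `(1 - 2 p) ^ (m / 2)`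
(`IsWindow.le_real`), which for `m` about `t / p` means `exp (-t)`.

No upper bound is needed. By invariance, the probabilities of the returns that take more than `k`
steps sum up to hitting probabilities (`sum_real_noReturn`), so that the rescaled tails of the
return times have an integral of at most `1`, which is the integral of the exponential density. A
decreasing function with this property and with the lower bound `exp (-t)` is close to `exp (-t)`,
and so is its integral (`tendsto_exp_of_le`). This gives both limit laws.
-/

noncomputable section

namespace ExpReturn

/-! ### Positions of the nonzero letters -/

/-- The position of the `n`-th nonzero letter (counted from `0`) in a sequence that starts with a
nonzero letter and has `omega n` zeros between the nonzero letters number `n - 1` and `n`. -/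
def letterPos : ℕ → ℕ
  | 0 => 0
  | n + 1 => letterPos n + 1 + omega (n + 1)

theorem letterPos_succ (n : ℕ) : letterPos (n + 1) = letterPos n + 1 + omega (n + 1) := rfl

theorem letterPos_strictMono : StrictMono letterPos :=
  strictMono_nat_of_lt_succ fun n => by rw [letterPos_succ]; omega

theorem pow_dvd_iff_le_omega {k n : ℕ} (hn : n ≠ 0) : 2 ^ k ∣ n ↔ k ≤ omega n :=
  padicValNat_dvd_iff_le hn

/-- Below the level `R`, the ruler sequence is periodic with period `2 ^ R`. -/
theorem omega_eq_of_modEq {R m n : ℕ} (hn : ¬ 2 ^ R ∣ n) (h : m ≡ n [MOD 2 ^ R]) :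
    omega m = omega n := by
  have hn0 : n ≠ 0 := by rintro rfl; exact hn (dvd_zero _)
  have hm : ¬ 2 ^ R ∣ m := fun h' => hn ((h.dvd_iff dvd_rfl).1 h')
  have hm0 : m ≠ 0 := by rintro rfl; exact hm (dvd_zero _)
  have key : ∀ k, k ≤ omega m ↔ k ≤ omega n := fun k => by
    rcases le_or_gt k R with hk | hk
    · rw [← pow_dvd_iff_le_omega hm0, ← pow_dvd_iff_le_omega hn0]
      exact h.dvd_iff (pow_dvd_pow 2 hk)
    · rw [← pow_dvd_iff_le_omega hm0, ← pow_dvd_iff_le_omega hn0]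
      exact ⟨fun h' => absurd ((pow_dvd_pow 2 hk.le).trans h') hm,
        fun h' => absurd ((pow_dvd_pow 2 hk.le).trans h') hn⟩
  exact le_antisymm ((key _).1 le_rfl) ((key _).2 le_rfl)

theorem omega_mul_pow {q : ℕ} (hq : q ≠ 0) (R : ℕ) : omega (q * 2 ^ R) = omega q + R := by
  unfold omega
  rw [padicValNat.mul hq (by positivity), padicValNat.prime_pow]

/-- The gaps inside a block of `2 ^ R` letters do not depend on the block. -/
theorem letterPos_mul_pow_add (q R : ℕ) {r : ℕ} (hr : r < 2 ^ R) :
    letterPos (q * 2 ^ R + r) = letterPos (q * 2 ^ R) + letterPos r := by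
  induction r with
  | zero => simp [letterPos]
  | succ r ih =>
    have h1 : omega (q * 2 ^ R + r + 1) = omega (r + 1) := by
      refine omega_eq_of_modEq (R := R) (fun h => ?_) ?_
      · exact absurd (Nat.le_of_dvd (by omega) h) (by omega)
      · simp [Nat.ModEq, add_assoc]
    rw [← add_assoc, letterPos_succ, letterPos_succ, h1, ih (by omega)]
    ring

theorem letterPos_succ_mul_pow_eq (q R : ℕ) :
    letterPos ((q + 1) * 2 ^ R) = letterPos (q * 2 ^ R) + letterPos (2 ^ R) + omega (q + 1) := by
  have hp : 0 < 2 ^ R := by positivity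
  obtain ⟨r, hr⟩ : ∃ r, 2 ^ R = r + 1 := ⟨2 ^ R - 1, by omega⟩
  have h1 : (q + 1) * 2 ^ R = q * 2 ^ R + r + 1 := by rw [add_mul, hr]; ring
  have h2 : omega (r + 1) = R := by rw [← hr]; exact padicValNat.prime_pow R
  have h3 : omega (q * 2 ^ R + r + 1) = omega (q + 1) + R := by
    rw [← h1]; exact omega_mul_pow (by omega) R
  rw [h1, letterPos_succ, letterPos_mul_pow_add q R (by omega), h3]
  conv_rhs => rw [hr, letterPos_succ, h2, ← hr]
  ring

theorem letterPos_two_pow (R : ℕ) : letterPos (2 ^ R) + 1 = 2 ^ (R + 1) := by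
  induction R with
  | zero => simp [letterPos, omega]
  | succ R ih =>
    have h := letterPos_succ_mul_pow_eq 1 R
    have h2 : omega (1 + 1) = 1 := by simp [omega]
    rw [h2, one_mul] at h
    rw [show 2 ^ (R + 1) = (1 + 1) * 2 ^ R by ring, h,
      show 2 ^ (R + 1 + 1) = 2 * 2 ^ (R + 1) by ring]
    omega

theorem letterPos_succ_mul_pow (q R : ℕ) :
    letterPos ((q + 1) * 2 ^ R) + 1 = letterPos (q * 2 ^ R) + 2 ^ (R + 1) + omega (q + 1) := by
  rw [letterPos_succ_mul_pow_eq, ← letterPos_two_pow]; ring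

theorem mul_le_letterPos (q R : ℕ) : q * (2 ^ (R + 1) - 1) ≤ letterPos (q * 2 ^ R) := by
  induction q with
  | zero => simp
  | succ q ih =>
    have := letterPos_succ_mul_pow q R
    have h2 : 0 < 2 ^ (R + 1) := by positivity
    rw [add_mul]; omega

theorem letterPos_le (n : ℕ) : letterPos n ≤ 2 * n := by
  induction n using Nat.strong_induction_on with
  | _ n ih =>
    rcases Nat.even_or_odd' n with ⟨m, rfl | rfl⟩
    · rcases Nat.eq_zero_or_pos m with rfl | hm
      · simp [letterPos]
      have key : ∀ q, letterPos (q * 2 ^ 1) = 2 * q + letterPos q := fun q => by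
        induction q with
        | zero => simp [letterPos]
        | succ q ihq =>
          have := letterPos_succ_mul_pow q 1
          rw [ihq] at this
          rw [letterPos_succ]; omega
      have := key m
      have := ih m (by omega)
      rw [show 2 * m = m * 2 ^ 1 by ring]; omega
    · have h1 : omega (2 * m + 1) = 0 := padicValNat.eq_zero_of_not_dvd (by omega)
      rw [letterPos_succ, h1]
      rcases Nat.eq_zero_or_pos m with rfl | hm
      · simp [letterPos]
      have := ih (2 * m) (by omega)
      omega

theorem letterPos_add_le (m k : ℕ) : letterPos m + k ≤ letterPos (m + k) := by
  induction k with
  | zero => simp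
  | succ k ih => rw [← add_assoc m, letterPos_succ]; omega

/-! ### Binary digits, keys and signs -/

/-- The set of the positions of the binary digits `1` of `n`. -/
def bits (n : ℕ) : Finset ℕ := (Finset.range n).filter fun i => n.testBit i

theorem mem_bits {n i : ℕ} : i ∈ bits n ↔ n.testBit i = true := by
  simp only [bits, Finset.mem_filter, Finset.mem_range, and_iff_right_iff_imp]
  intro h
  exact i.lt_two_pow_self.trans_le (Nat.ge_two_pow_of_testBit h)

theorem bits_injective : Function.Injective bits := fun m n h =>
  Nat.eq_of_testBit_eq fun i => by
    have : i ∈ bits m ↔ i ∈ bits n := by rw [h]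
    rw [mem_bits, mem_bits] at this
    exact Bool.eq_iff_iff.2 this

theorem lt_of_mem_bits {R r i : ℕ} (hr : r < 2 ^ R) (hi : i ∈ bits r) : i < R := by
  by_contra h
  have := Nat.ge_two_pow_of_testBit (mem_bits.1 hi)
  have := Nat.pow_le_pow_right (n := 2) (by norm_num) (not_lt.1 h)
  omega

theorem mem_bits_mul_pow {q R i : ℕ} : i ∈ bits (q * 2 ^ R) ↔ R ≤ i ∧ i - R ∈ bits q := by
  rw [mem_bits, mem_bits, Nat.testBit_mul_two_pow]; simp

theorem mem_bits_mul_pow_add {q R r i : ℕ} (hr : r < 2 ^ R) :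
    i ∈ bits (q * 2 ^ R + r) ↔ i ∈ bits r ∨ i ∈ bits (q * 2 ^ R) := by
  rw [mem_bits_mul_pow, mem_bits, mul_comm, Nat.testBit_two_pow_mul_add q hr]
  split_ifs with h
  · rw [mem_bits]; simp [h]
  · refine ⟨fun h' => Or.inr ⟨not_lt.1 h, mem_bits.2 h'⟩, ?_⟩
    rintro (h' | h')
    · exact absurd (lt_of_mem_bits hr h') h
    · exact mem_bits.1 h'.2

open Classical in
/-- The binary digits of `n` outside the set `C` of flip positions. -/
def key (C : Set ℕ) (n : ℕ) : Finset ℕ := (bits n).filter (· ∉ C)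

open Classical in
/-- The parity of the number of binary digits `1` of `n` at flip positions. -/
def par (C : Set ℕ) (n : ℕ) : Bool := ((bits n).filter (· ∈ C)).card.bodd

/-- The sign of the `n`-th nonzero letter for a family `η` of free signs: the sign with index
`key C n`, reversed once for each digit `1` of `n` at a flip position. -/
def sign (C : Set ℕ) (η : Finset ℕ → Bool) (n : ℕ) : Bool := η (key C n) ^^ par C n

theorem mem_key {C : Set ℕ} {n i : ℕ} : i ∈ key C n ↔ i ∈ bits n ∧ i ∉ C := by
  simp [key]

/-- The low and the high binary digits contribute separately to the key. The symmetric difference is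
a disjoint union, written so that it is injective in each argument. -/
theorem key_mul_pow_add (C : Set ℕ) (q : ℕ) {R r : ℕ} (hr : r < 2 ^ R) :
    key C (q * 2 ^ R + r) = symmDiff (key C r) (key C (q * 2 ^ R)) := by
  ext i
  rw [Finset.mem_symmDiff, mem_key, mem_key, mem_key, mem_bits_mul_pow_add hr]
  have : i ∈ bits r → i ∉ bits (q * 2 ^ R) := fun h h' =>
    absurd (lt_of_mem_bits hr h) (not_lt.2 (mem_bits_mul_pow.1 h').1)
  tauto

theorem par_mul_pow_add (C : Set ℕ) (q : ℕ) {R r : ℕ} (hr : r < 2 ^ R) :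
    par C (q * 2 ^ R + r) = (par C r ^^ par C (q * 2 ^ R)) := by
  classical
  have h : (bits (q * 2 ^ R + r)).filter (· ∈ C) =
      (bits r).filter (· ∈ C) ∪ (bits (q * 2 ^ R)).filter (· ∈ C) := by
    ext i
    simp only [Finset.mem_union, Finset.mem_filter, mem_bits_mul_pow_add hr]
    tauto
  have hd : Disjoint ((bits r).filter (· ∈ C)) ((bits (q * 2 ^ R)).filter (· ∈ C)) := by
    rw [Finset.disjoint_left]
    intro i hi hi'
    exact absurd (lt_of_mem_bits hr (Finset.mem_filter.1 hi).1)
      (not_lt.2 (mem_bits_mul_pow.1 (Finset.mem_filter.1 hi').1).1)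
  unfold par
  rw [← Nat.bodd_add, ← Finset.card_union_of_disjoint hd, ← h]

/-- The sequence with nonzero letters at the positions `letterPos n`, where the sign `false` stands
for the letter `1` and the sign `true` for the letter `2`. -/
def point (C : Set ℕ) (η : Finset ℕ → Bool) : Point := fun j =>
  open Classical in
  if h : ∃ n, letterPos n = j then (if sign C η h.choose then 2 else 1) else 0

theorem point_letterPos (C : Set ℕ) (η : Finset ℕ → Bool) (n : ℕ) :
    point C η (letterPos n) = if sign C η n then 2 else 1 := by
  have h : ∃ m, letterPos m = letterPos n := ⟨n, rfl⟩
  have h' : h.choose = n := letterPos_strictMono.injective h.choose_spec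
  simp only [point, dif_pos h, h']

theorem point_eq_zero {C : Set ℕ} {η : Finset ℕ → Bool} {j : ℕ} (h : ∀ n, letterPos n ≠ j) :
    point C η j = 0 := by
  have h' : ¬ ∃ n, letterPos n = j := by simpa using h
  simp only [point, dif_neg h']

theorem point_ne_zero_iff {C : Set ℕ} {η : Finset ℕ → Bool} {j : ℕ} :
    point C η j ≠ 0 ↔ ∃ n, letterPos n = j := by
  constructor
  · intro h
    by_contra h'
    exact h (point_eq_zero (by simpa using h'))
  · rintro ⟨n, rfl⟩
    rw [point_letterPos]
    split_ifs <;> decide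

theorem point_letterPos_eq_iff {C C' : Set ℕ} {η η' : Finset ℕ → Bool} {m n : ℕ} :
    point C η (letterPos m) = point C' η' (letterPos n) ↔ sign C η m = sign C' η' n := by
  rw [point_letterPos, point_letterPos]
  cases sign C η m <;> cases sign C' η' n <;> simp

/-- The action of the index `m` on families of signs: a translation of the indices by `key C m` and
a global reversal if `par C m` is odd. -/
def move (C : Set ℕ) (m : ℕ) (η : Finset ℕ → Bool) : Finset ℕ → Bool :=
  fun a => η (symmDiff a (key C m)) ^^ par C m

theorem sign_move (C : Set ℕ) (η : Finset ℕ → Bool) (q : ℕ) {R r : ℕ} (hr : r < 2 ^ R) :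
    sign C (move C (q * 2 ^ R) η) r = sign C η (q * 2 ^ R + r) := by
  simp only [sign, move, key_mul_pow_add C q hr, par_mul_pow_add C q hr]
  cases par C r <;> cases par C (q * 2 ^ R) <;> simp

/-- The `q`-th block of `2 ^ R` nonzero letters is the initial block for moved signs. -/
theorem point_block (C : Set ℕ) (η : Finset ℕ → Bool) (q R : ℕ) {i : ℕ} (hi : i + 1 < 2 ^ (R + 1)) :
    point C η (letterPos (q * 2 ^ R) + i) = point C (move C (q * 2 ^ R) η) i := by
  have hR := letterPos_two_pow R
  by_cases h : ∃ r, letterPos r = i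
  · obtain ⟨r, rfl⟩ := h
    have hr : r < 2 ^ R := letterPos_strictMono.lt_iff_lt.1 (by omega)
    rw [← letterPos_mul_pow_add q R hr, point_letterPos, point_letterPos, sign_move C η q hr]
  · rw [not_exists] at h
    rw [point_eq_zero h, point_eq_zero]
    intro n hn
    have h1 : q * 2 ^ R ≤ n := letterPos_strictMono.le_iff_le.1 (by omega)
    have h2 : n < (q + 1) * 2 ^ R := letterPos_strictMono.lt_iff_lt.1 (by
      have := letterPos_succ_mul_pow q R; omega)
    obtain ⟨r, rfl⟩ := Nat.exists_eq_add_of_le h1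
    rw [letterPos_mul_pow_add q R (by rw [add_mul] at h2; omega)] at hn
    exact h r (by omega)

theorem shift_iterate_apply (i : ℕ) (x : Point) (j : ℕ) : shift^[i] x j = x (i + j) := by
  induction i generalizing x with
  | zero => simp
  | succ i ih => rw [Function.iterate_succ_apply, ih]; simp only [shift]; congr 1; ring

/-! ### Occurrences of a word -/

/-- The number of zeros between two nonzero letters determines the position of the next one. -/
theorem letterPos_add_of_omega_eq {m n l : ℕ}
    (h : ∀ j, 0 < j → j < l → omega (m + j) = omega (n + j)) {j : ℕ} (hj : j < l) :
    letterPos (m + j) + letterPos n = letterPos (n + j) + letterPos m := by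
  induction j with
  | zero => simp [add_comm]
  | succ j ih =>
    have h1 := ih (by omega)
    have h2 := h (j + 1) (by omega) hj
    rw [← add_assoc, ← add_assoc] at *
    rw [letterPos_succ, letterPos_succ, h2]
    omega

theorem pow_dvd_of_le_omega {k n : ℕ} (h : k ≤ omega n) : 2 ^ k ∣ n := by
  rcases eq_or_ne n 0 with rfl | hn
  · exact dvd_zero _
  · exact (pow_dvd_iff_le_omega hn).2 h

/-- Numbers whose ruler values agree on a window, and whose ruler values at the ends of the window
are large enough, are congruent modulo the largest power of `2` that the window can detect. -/
theorem modEq_of_omega_eq {m n l R s r : ℕ}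
    (h : ∀ j, 0 < j → j < l → omega (m + j) = omega (n + j))
    (hR : R = 0 ∨ ∃ j, 0 < j ∧ j < l ∧ 2 ^ (R - 1) ∣ n + j ∧ ¬ 2 ^ R ∣ n + j)
    (hsm : 2 ^ s ∣ m) (hsn : 2 ^ s ∣ n) (hrm : 2 ^ r ∣ m + l) (hrn : 2 ^ r ∣ n + l) :
    m ≡ n [MOD 2 ^ max R (max s r)] := by
  have h0 : m ≡ n [MOD 2 ^ R] := by
    rcases hR with rfl | ⟨j, hj0, hjl, hd, hnd⟩
    · exact Nat.modEq_one
    · have hR0 : R ≠ 0 := by rintro rfl; simp at hnd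
      obtain ⟨k, rfl⟩ := Nat.exists_eq_succ_of_ne_zero hR0
      simp only [Nat.succ_eq_add_one, Nat.add_sub_cancel] at hd hnd ⊢
      have hw := h j hj0 hjl
      have hd' : 2 ^ k ∣ m + j := pow_dvd_of_le_omega (by
        rw [hw]; exact (pow_dvd_iff_le_omega (by omega)).1 hd)
      have hnd' : ¬ 2 ^ (k + 1) ∣ m + j := fun h' => hnd (pow_dvd_of_le_omega (by
        rw [← hw]; exact (pow_dvd_iff_le_omega (by omega)).1 h'))
      obtain ⟨u, hu⟩ := hd
      obtain ⟨v, hv⟩ := hd'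
      rw [hu, pow_succ] at hnd
      rw [hv, pow_succ] at hnd'
      have hu2 : u % 2 = 1 := by
        by_contra h2
        exact hnd (mul_dvd_mul_left _ (Nat.dvd_of_mod_eq_zero (by omega)))
      have hv2 : v % 2 = 1 := by
        by_contra h2
        exact hnd' (mul_dvd_mul_left _ (Nat.dvd_of_mod_eq_zero (by omega)))
      have : m + j ≡ n + j [MOD 2 ^ (k + 1)] := by
        rw [hu, hv, pow_succ]
        exact Nat.ModEq.mul_left' _ (show v % 2 = u % 2 by omega)
      exact Nat.ModEq.add_right_cancel' j this
  have h1 : m ≡ n [MOD 2 ^ s] :=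
    ((Nat.modEq_zero_iff_dvd).2 hsm).trans ((Nat.modEq_zero_iff_dvd).2 hsn).symm
  have h2 : m ≡ n [MOD 2 ^ r] := Nat.ModEq.add_right_cancel' l
    (((Nat.modEq_zero_iff_dvd).2 hrm).trans ((Nat.modEq_zero_iff_dvd).2 hrn).symm)
  rcases max_choice R (max s r) with h' | h' <;> rw [h']
  · exact h0
  · rcases max_choice s r with h' | h' <;> rw [h']
    · exact h1
    · exact h2

/-- A word with a nonzero letter that occurs in some sequence `point C η₀` occurs in the sequences
`point C η` exactly where a fixed window of `l` consecutive letters in a block of `2 ^ R` letters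
has the signs of the word. The number `s` counts the zeros at the start of the word. -/
theorem exists_window (C : Set ℕ) (η₀ : Finset ℕ → Bool) {i₀ n : ℕ}
    (hne : ∃ j < n, point C η₀ (i₀ + j) ≠ 0) :
    ∃ R r₀ q₀ l s : ℕ, r₀ + l ≤ 2 ^ R ∧ 0 < l ∧ s ≤ R ∧
      ((Finset.range n).filter fun j => point C η₀ (i₀ + j) ≠ 0).card ≤ l ∧
      ∀ η i, (∀ j < n, point C η (i + j) = point C η₀ (i₀ + j)) ↔
        ∃ q, i + s = letterPos (q * 2 ^ R + r₀) ∧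
          ∀ j < l, sign C η (q * 2 ^ R + r₀ + j) = sign C η₀ (q₀ * 2 ^ R + r₀ + j) := by
  have hex : ∀ a, ∃ m, a ≤ letterPos m := fun a => ⟨a, by
    have := letterPos_add_le 0 a
    rw [zero_add] at this; exact (Nat.le_add_left _ _).trans this⟩
  -- The letters of the word have the numbers `m₀, …, e - 1`.
  let m₀ := Nat.find (hex i₀)
  let e := Nat.find (hex (i₀ + n))
  have hm₀ : i₀ ≤ letterPos m₀ := Nat.find_spec (hex i₀)
  have hm₀' : ∀ m, i₀ ≤ letterPos m → m₀ ≤ m := fun m h => Nat.find_min' (hex i₀) h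
  have he : i₀ + n ≤ letterPos e := Nat.find_spec (hex (i₀ + n))
  have he' : ∀ m, i₀ + n ≤ letterPos m → e ≤ m := fun m h => Nat.find_min' (hex (i₀ + n)) h
  clear_value m₀ e
  have hlt : m₀ < e := by
    obtain ⟨j, hj, hj'⟩ := hne
    obtain ⟨m, hm⟩ := point_ne_zero_iff.1 hj'
    have h1 : m₀ ≤ m := hm₀' m (by omega)
    have h2 : m < e := letterPos_strictMono.lt_iff_lt.1 (by omega)
    omega
  obtain ⟨l, rfl⟩ := Nat.exists_eq_add_of_lt hlt
  have hlast : letterPos (m₀ + l) < i₀ + n := by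
    by_contra h
    have := he' _ (not_lt.1 h)
    omega
  have hmono : ∀ {a b}, a ≤ b → letterPos a ≤ letterPos b :=
    fun h => letterPos_strictMono.monotone h
  have hfirst := hmono (Nat.le_add_right m₀ l)
  obtain ⟨s, hs⟩ : ∃ s, letterPos m₀ = i₀ + s := ⟨letterPos m₀ - i₀, by omega⟩
  obtain ⟨r, hr⟩ : ∃ r, letterPos (m₀ + l) + 1 + r = i₀ + n :=
    ⟨i₀ + n - (letterPos (m₀ + l) + 1), by omega⟩
  have hsm₀ : 2 ^ s ∣ m₀ := by
    rcases Nat.eq_zero_or_pos m₀ with h0 | h0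
    · rw [h0]; exact dvd_zero _
    · obtain ⟨k, rfl⟩ := Nat.exists_eq_succ_of_ne_zero h0.ne'
      apply pow_dvd_of_le_omega
      have h1 : letterPos k < i₀ := by
        by_contra h
        have := hm₀' _ (not_lt.1 h)
        omega
      have := letterPos_succ k
      simp only [Nat.succ_eq_add_one] at *
      omega
  have hrm₀ : 2 ^ r ∣ m₀ + (l + 1) := by
    apply pow_dvd_of_le_omega
    have := letterPos_succ (m₀ + l)
    rw [← add_assoc]
    omega
  have hexR : ∃ R, ∀ j, 0 < j → j < l + 1 → ¬ 2 ^ R ∣ m₀ + j :=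
    ⟨m₀ + l, fun j h0 hl hd => by
      have := Nat.le_of_dvd (by omega) hd
      have := (m₀ + l).lt_two_pow_self
      omega⟩
  obtain ⟨R₁, hR₁, hR₁'⟩ : ∃ R₁, (∀ j, 0 < j → j < l + 1 → ¬ 2 ^ R₁ ∣ m₀ + j) ∧
      (R₁ = 0 ∨ ∃ j, 0 < j ∧ j < l + 1 ∧ 2 ^ (R₁ - 1) ∣ m₀ + j ∧ ¬ 2 ^ R₁ ∣ m₀ + j) := by
    classical
    refine ⟨Nat.find hexR, Nat.find_spec hexR, ?_⟩
    rcases Nat.eq_zero_or_pos (Nat.find hexR) with h0 | h0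
    · exact Or.inl h0
    · right
      have := Nat.find_min hexR (m := Nat.find hexR - 1) (by omega)
      push Not at this
      obtain ⟨j, h1, h2, h3⟩ := this
      exact ⟨j, h1, h2, h3, Nat.find_spec hexR j h1 h2⟩
  obtain ⟨R, hR⟩ : ∃ R, R = max R₁ (max s r) := ⟨_, rfl⟩
  have hR₁R : R₁ ≤ R := by omega
  have hp : 0 < 2 ^ R := by positivity
  have hinner : ∀ j, 0 < j → j < l + 1 → ¬ 2 ^ R ∣ m₀ + j := fun j h0 hl hd =>
    hR₁ j h0 hl ((pow_dvd_pow 2 hR₁R).trans hd)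
  have hdm : m₀ / 2 ^ R * 2 ^ R + m₀ % 2 ^ R = m₀ := Nat.div_add_mod' _ _
  have hmod : m₀ % 2 ^ R < 2 ^ R := Nat.mod_lt _ hp
  refine ⟨R, m₀ % 2 ^ R, m₀ / 2 ^ R, l + 1, s, ?_, by omega, by omega, ?_, fun η i => ?_⟩
  · by_contra h
    refine hinner (2 ^ R - m₀ % 2 ^ R) (by omega) (by omega) ?_
    refine ⟨m₀ / 2 ^ R + 1, ?_⟩
    rw [mul_add, mul_comm (2 ^ R)]
    omega
  · -- The nonzero letters of the word inject into the numbers `m₀, …, m₀ + l`.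
    calc _ ≤ ((Finset.range (l + 1)).image fun k => letterPos (m₀ + k) - i₀).card := by
          refine Finset.card_le_card fun j hj => ?_
          obtain ⟨hj, hj'⟩ := Finset.mem_filter.1 hj
          obtain ⟨m, hm⟩ := point_ne_zero_iff.1 hj'
          have hjn := Finset.mem_range.1 hj
          have h1 : m₀ ≤ m := hm₀' m (by omega)
          have h2 : m < m₀ + l + 1 := letterPos_strictMono.lt_iff_lt.1 (by omega)
          refine Finset.mem_image.2 ⟨m - m₀, Finset.mem_range.2 (by omega), ?_⟩
          rw [show m₀ + (m - m₀) = m by omega]; omega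
      _ ≤ _ := Finset.card_image_le.trans (by simp)
  · rw [hdm]
    constructor
    · intro h
      have hL : ∀ j < n, (∃ a, letterPos a = i + j) ↔ ∃ a, letterPos a = i₀ + j := fun j hj => by
        rw [← point_ne_zero_iff (C := C) (η := η), ← point_ne_zero_iff (C := C) (η := η₀), h j hj]
      obtain ⟨m, hm⟩ := (hL s (by omega)).2 ⟨m₀, hs⟩
      have hpos : ∀ k, k < l + 1 → letterPos (m + k) + i₀ = letterPos (m₀ + k) + i := by
        intro k hk
        induction k with
        | zero => simp; omega
        | succ k ih =>
          have ih' := ih (by omega)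
          have h1 : letterPos (m₀ + (k + 1)) ≤ letterPos (m₀ + l) := hmono (by omega)
          have h2 : letterPos m₀ < letterPos (m₀ + (k + 1)) := letterPos_strictMono (by omega)
          have h3 : letterPos (m₀ + k) < letterPos (m₀ + (k + 1)) :=
            letterPos_strictMono (by omega)
          have h4 : letterPos (m + k) < letterPos (m + (k + 1)) := letterPos_strictMono (by omega)
          obtain ⟨a, ha⟩ := (hL (letterPos (m₀ + (k + 1)) - i₀) (by omega)).2
            ⟨m₀ + (k + 1), by omega⟩
          have h5 : m + (k + 1) ≤ a := letterPos_strictMono.lt_iff_lt.1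
            (show letterPos (m + k) < letterPos a by omega)
          have h6 := hmono h5
          have h7 : letterPos m ≤ letterPos (m + k) := hmono (by omega)
          obtain ⟨c, hc⟩ := (hL (letterPos (m + (k + 1)) - i) (by omega)).1
            ⟨m + (k + 1), by omega⟩
          have h8 : m₀ + (k + 1) ≤ c := letterPos_strictMono.lt_iff_lt.1
            (show letterPos (m₀ + k) < letterPos c by omega)
          have h9 := hmono h8
          omega
      have hom : ∀ j, 0 < j → j < l + 1 → omega (m + j) = omega (m₀ + j) := fun j h0 hl => by
        obtain ⟨k, rfl⟩ := Nat.exists_eq_succ_of_ne_zero h0.ne'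
        have h1 := hpos k (by omega)
        have h2 := hpos (k + 1) (by omega)
        rw [← add_assoc, ← add_assoc, letterPos_succ, letterPos_succ] at h2
        simp only [Nat.succ_eq_add_one, ← add_assoc]
        omega
      have hsm : 2 ^ s ∣ m := by
        rcases Nat.eq_zero_or_pos m with h0 | h0
        · rw [h0]; exact dvd_zero _
        · obtain ⟨k, rfl⟩ := Nat.exists_eq_succ_of_ne_zero h0.ne'
          apply pow_dvd_of_le_omega
          simp only [Nat.succ_eq_add_one] at *
          have h2 := letterPos_succ k
          have h1 : letterPos k < i := by
            by_contra h
            obtain ⟨a, ha⟩ := (hL (letterPos k - i) (by omega)).1 ⟨k, by omega⟩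
            have := hmono (hm₀' a (by omega))
            omega
          omega
      have hrm : 2 ^ r ∣ m + (l + 1) := by
        apply pow_dvd_of_le_omega
        have h2 := letterPos_succ (m + l)
        have h3 := hpos l (by omega)
        by_contra h
        rw [← add_assoc] at h
        obtain ⟨a, ha⟩ := (hL (letterPos (m + l + 1) - i) (by omega)).1 ⟨m + l + 1, by omega⟩
        have := hmono (show m₀ + l + 1 ≤ a from letterPos_strictMono.lt_iff_lt.1
          (show letterPos (m₀ + l) < letterPos a by omega))
        omega
      have hcong := modEq_of_omega_eq hom hR₁' hsm hsm₀ hrm hrm₀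
      rw [← hR] at hcong
      have hdm' : m / 2 ^ R * 2 ^ R + m₀ % 2 ^ R = m := by
        rw [← show m % 2 ^ R = m₀ % 2 ^ R from hcong]; exact Nat.div_add_mod' _ _
      refine ⟨m / 2 ^ R, by rw [hdm', hm], fun j hj => ?_⟩
      rw [hdm', ← point_letterPos_eq_iff]
      have h1 := hpos j hj
      have h2 : letterPos m ≤ letterPos (m + j) := hmono (by omega)
      have h3 : letterPos (m₀ + j) ≤ letterPos (m₀ + l) := hmono (by omega)
      have := h (letterPos (m + j) - i) (by omega)
      rwa [show i + (letterPos (m + j) - i) = letterPos (m + j) by omega,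
        show i₀ + (letterPos (m + j) - i) = letterPos (m₀ + j) by omega] at this
    · rintro ⟨q, hq, hsign⟩
      obtain ⟨m, hm⟩ : ∃ m, m = q * 2 ^ R + m₀ % 2 ^ R := ⟨_, rfl⟩
      rw [← hm] at hq hsign
      have hcong : m ≡ m₀ [MOD 2 ^ R] := by
        rw [hm]; simp [Nat.ModEq]
      have hom : ∀ j, 0 < j → j < l + 1 → omega (m + j) = omega (m₀ + j) := fun j h0 hl =>
        omega_eq_of_modEq (hinner j h0 hl) (Nat.ModEq.add_right j hcong)
      have hsm : 2 ^ s ∣ m :=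
        (hcong.dvd_iff (pow_dvd_pow 2 (by omega))).2 hsm₀
      have hrm : 2 ^ r ∣ m + (l + 1) :=
        ((Nat.ModEq.add_right (l + 1) hcong).dvd_iff (pow_dvd_pow 2 (by omega))).2 hrm₀
      have hpos := fun {k} (hk : k < l + 1) => letterPos_add_of_omega_eq hom hk
      intro j hj
      by_cases hl : ∃ k < l + 1, letterPos (m₀ + k) = i₀ + j
      · obtain ⟨k, hk, hk'⟩ := hl
        have := hpos hk
        rw [← hk', show i + j = letterPos (m + k) by omega, point_letterPos_eq_iff]
        exact hsign k hk
      · rw [point_eq_zero, point_eq_zero]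
        · intro a ha
          have h1 := hm₀' a (by omega)
          have h2 : a < m₀ + l + 1 := letterPos_strictMono.lt_iff_lt.1 (by omega)
          exact hl ⟨a - m₀, by omega, by rw [show m₀ + (a - m₀) = a by omega, ha]⟩
        · intro a ha
          have h1 : m ≤ a := by
            by_contra h
            obtain ⟨k, rfl⟩ := Nat.exists_eq_succ_of_ne_zero (show m ≠ 0 by omega)
            have h2 := (pow_dvd_iff_le_omega (by omega)).1 hsm
            have h3 : letterPos a ≤ letterPos k := hmono (by omega)
            have h4 := letterPos_succ k
            simp only [Nat.succ_eq_add_one] at *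
            omega
          have h2 : a < m + l + 1 := by
            by_contra h
            have h2 := (pow_dvd_iff_le_omega (by omega)).1 hrm
            have h3 : letterPos (m + l + 1) ≤ letterPos a := hmono (by omega)
            have h4 := letterPos_succ (m + l)
            have h5 := hpos (k := l) (by omega)
            rw [← add_assoc] at h2
            omega
          obtain ⟨k, rfl⟩ := Nat.exists_eq_add_of_le h1
          have := hpos (k := k) (by omega)
          exact hl ⟨k, by omega, by omega⟩

/-! ### Fair coins -/

/-- The law of a fair coin. -/
def coin : Measure Bool := (PMF.uniformOfFintype Bool).toMeasure

instance : IsProbabilityMeasure coin := by unfold coin; infer_instance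

/-- The law of a family of independent fair coins that is indexed by the keys. -/
def coins : Measure (Finset ℕ → Bool) := Measure.infinitePi fun _ => coin

instance : IsProbabilityMeasure coins := by unfold coins; infer_instance

theorem coin_singleton (b : Bool) : coin {b} = 2⁻¹ := by
  unfold coin
  rw [PMF.toMeasure_apply_singleton _ _ (measurableSet_singleton b)]
  simp

theorem coins_forall_eq (F : Finset (Finset ℕ)) (τ : Finset ℕ → Bool) :
    coins {η | ∀ a ∈ F, η a = τ a} = 2⁻¹ ^ F.card := by
  have h : {η : Finset ℕ → Bool | ∀ a ∈ F, η a = τ a} =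
      Set.pi (F : Set (Finset ℕ)) fun a => {τ a} := by
    ext η; simp [Set.mem_pi]
  rw [h, coins, Measure.infinitePi_pi _ fun a _ => measurableSet_singleton (τ a)]
  simp [coin_singleton]

theorem measurePreserving_move (C : Set ℕ) (m : ℕ) : MeasurePreserving (move C m) coins coins := by
  have h1 : MeasurePreserving (fun (η : Finset ℕ → Bool) a => η (symmDiff a (key C m)))
      coins coins :=
    ⟨by fun_prop, Measure.map_infinitePi_infinitePi_of_inj (symmDiff_left_injective (key C m))⟩
  have hx : MeasurePreserving (fun b : Bool => (b ^^ par C m)) coin coin := by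
    refine ⟨measurable_of_finite _, Measure.ext_of_singleton fun b => ?_⟩
    rw [Measure.map_apply (measurable_of_finite _) (measurableSet_singleton b)]
    have : (fun b : Bool => (b ^^ par C m)) ⁻¹' {b} = {b ^^ par C m} := by
      ext c; cases b <;> cases c <;> cases par C m <;> simp
    rw [this, coin_singleton, coin_singleton]
  have h2 : MeasurePreserving (fun (η : Finset ℕ → Bool) a => (η a ^^ par C m)) coins coins := by
    have hm : ∀ _ : Finset ℕ, Measurable fun b : Bool => (b ^^ par C m) :=
      fun _ => measurable_of_finite _
    refine ⟨measurable_pi_lambda _ fun a => (hm a).comp (measurable_pi_apply a), ?_⟩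
    unfold coins
    rw [Measure.infinitePi_map_pi (fun _ => coin) hm]
    simp only [hx.map_eq]
  exact h2.comp h1

/-- Disjoint families of coins are independent. -/
theorem coins_forall_mem {ι κ : Type*} {f : ι → κ → Finset ℕ}
    (hf : Function.Injective fun p : ι × κ => f p.1 p.2) (K : Finset ι)
    (G : ι → Set (κ → Bool)) (hG : ∀ i, MeasurableSet (G i)) :
    coins {η | ∀ i ∈ K, (fun a => η (f i a)) ∈ G i} =
      ∏ i ∈ K, Measure.infinitePi (fun _ : κ => coin) (G i) := by
  have h1 : coins.map (fun η (p : ι × κ) => η (f p.1 p.2)) =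
      Measure.infinitePi fun _ : ι × κ => coin :=
    Measure.map_infinitePi_infinitePi_of_inj hf
  have h2 : coins.map (fun η i a => η (f i a)) =
      Measure.infinitePi fun _ : ι => Measure.infinitePi fun _ : κ => coin := by
    rw [← Measure.infinitePi_map_curry, ← h1, Measure.map_map (by fun_prop) (by fun_prop)]
    rfl
  rw [← Measure.infinitePi_pi (fun _ : ι => Measure.infinitePi fun _ : κ => coin)
    fun i _ => hG i, ← h2, Measure.map_apply (by fun_prop)
      (MeasurableSet.pi K.countable_toSet fun i _ => hG i)]
  rfl

/-- Independent uniform words `fun a => η (f i a)` are compared with two distinct words `τ true` and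
`τ false`. The probability that the word number `c q` is `τ (e q)`, while the words number
`c q'` differ from `τ (e q')` for all `q' ∈ S`, is at least what it would be if every single word
were compared with at most one of `τ true` and `τ false` and had the probability `√(1 - 2 p)` to
differ from it. -/
theorem le_coins_first_match {ι κ : Type*} [Fintype κ] {f : ι → κ → Finset ℕ}
    (hf : Function.Injective fun p : ι × κ => f p.1 p.2) (τ : Bool → κ → Bool)
    (hτ : τ true ≠ τ false) (c : ℕ → ι) (e : ℕ → Bool) (q : ℕ) (S : Finset ℕ)
    (hS : ∀ q' ∈ S, c q' = c q → e q' ≠ e q) {p : ℝ} (hp : p = 2⁻¹ ^ Fintype.card κ) :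
    p * √(1 - 2 * p) ^ S.card ≤ coins.real {η | (fun a => η (f (c q) a)) = τ (e q) ∧
      ∀ q' ∈ S, (fun a => η (f (c q') a)) ≠ τ (e q')} := by
  classical
  set m : Measure (κ → Bool) := Measure.infinitePi fun _ => coin with hm
  have hsing : ∀ v, m.real {v} = p := fun v => by
    rw [hp, measureReal_def, hm, Measure.infinitePi_eq_pi, Measure.pi_singleton]
    simp [coin_singleton]
  have hp0 : 0 ≤ p := by rw [hp]; positivity
  have hp2 : 2 * p ≤ 1 := by
    have h := measureReal_mono (μ := m) (Set.subset_univ ({τ true} ∪ {τ false}))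
    rw [measureReal_union (by simpa using hτ) (measurableSet_singleton _), hsing, hsing] at h
    simpa [two_mul] using h
  set s := √(1 - 2 * p) with hs
  have hs0 : 0 ≤ s := Real.sqrt_nonneg _
  have hs2 : s ^ 2 = 1 - 2 * p := Real.sq_sqrt (by linarith)
  have hs1 : s ≤ 1 := by nlinarith
  have hsp : s ≤ 1 - p := Real.sqrt_le_iff.2 ⟨by linarith, by nlinarith⟩
  -- The words that the word number `i` is compared with.
  let forb : ι → Finset (κ → Bool) := fun i =>
    (S.filter fun q' => c q' = i).image fun q' => τ (e q')
  let G : ι → Set (κ → Bool) := fun i => if i = c q then {τ (e q)} else (forb i : Set _)ᶜ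
  have hGm : ∀ i, MeasurableSet (G i) := fun i => (Set.toFinite _).measurableSet
  have hGforb : ∀ i, i ∈ (S.image c).erase (c q) →
      s ^ (S.filter fun q' => c q' = i).card ≤ m.real (G i) := by
    intro i hi
    have hi' := (Finset.mem_erase.1 hi).1
    have hcard1 : (forb i).card ≤ (S.filter fun q' => c q' = i).card := Finset.card_image_le
    have hcard2 : (forb i).card ≤ 2 := by
      calc (forb i).card ≤ ((Finset.univ : Finset Bool).image τ).card :=
            Finset.card_le_card fun v hv => by
              obtain ⟨q', -, rfl⟩ := Finset.mem_image.1 hv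
              exact Finset.mem_image_of_mem _ (Finset.mem_univ _)
        _ ≤ 2 := Finset.card_image_le
    have hval : m.real (G i) = 1 - (forb i).card * p := by
      simp only [G, if_neg hi']
      rw [probReal_compl_eq_one_sub (forb i).measurableSet, ← sum_measureReal_singleton]
      simp [hsing]
    obtain ⟨q', hq', hcq'⟩ := Finset.mem_image.1 (Finset.mem_erase.1 hi).2
    have hpos : 0 < (S.filter fun q' => c q' = i).card :=
      Finset.card_pos.2 ⟨q', Finset.mem_filter.2 ⟨hq', hcq'⟩⟩
    rw [hval]
    rcases Nat.lt_or_ge 1 (S.filter fun q' => c q' = i).card with h | h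
    · have h1 : ((forb i).card : ℝ) ≤ 2 := by exact_mod_cast hcard2
      calc s ^ (S.filter fun q' => c q' = i).card ≤ s ^ 2 := pow_le_pow_of_le_one hs0 hs1 h
        _ ≤ _ := by rw [hs2]; nlinarith
    · have h1 : ((forb i).card : ℝ) ≤ 1 := by exact_mod_cast hcard1.trans h
      rw [show (S.filter fun q' => c q' = i).card = 1 by omega, pow_one]
      nlinarith
  have hsum : ∑ i ∈ (S.image c).erase (c q), (S.filter fun q' => c q' = i).card ≤ S.card := by
    rw [Finset.card_eq_sum_card_image c S]
    exact Finset.sum_le_sum_of_subset (Finset.erase_subset _ _)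
  calc p * s ^ S.card
      ≤ p * s ^ ∑ i ∈ (S.image c).erase (c q), (S.filter fun q' => c q' = i).card :=
        mul_le_mul_of_nonneg_left (pow_le_pow_of_le_one hs0 hs1 hsum) hp0
    _ ≤ p * ∏ i ∈ (S.image c).erase (c q), m.real (G i) := by
        rw [← Finset.prod_pow_eq_pow_sum]
        exact mul_le_mul_of_nonneg_left
          (Finset.prod_le_prod (fun _ _ => pow_nonneg hs0 _) hGforb) hp0
    _ = ∏ i ∈ insert (c q) ((S.image c).erase (c q)), m.real (G i) := by
        rw [Finset.prod_insert (Finset.notMem_erase _ _)]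
        simp only [G, if_true, hsing]
    _ = coins.real {η | ∀ i ∈ insert (c q) ((S.image c).erase (c q)),
          (fun a => η (f i a)) ∈ G i} := by
        rw [measureReal_def, coins_forall_mem hf _ G hGm, ENNReal.toReal_prod]
        rfl
    _ ≤ _ := by
        refine measureReal_mono fun η hη => ?_
        have h0 : (fun a => η (f (c q) a)) = τ (e q) := by
          have := hη (c q) (Finset.mem_insert_self _ _)
          simpa only [G, if_true, Set.mem_singleton_iff] using this
        refine ⟨h0, fun q' hq' h' => ?_⟩
        by_cases hc : c q' = c q
        · have hne := hS q' hq' hc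
          rw [hc, h0] at h'
          revert hne h'
          cases e q' <;> cases e q <;> simp [hτ, hτ.symm]
        · have := hη (c q') (Finset.mem_insert_of_mem
            (Finset.mem_erase.2 ⟨hc, Finset.mem_image_of_mem _ hq'⟩))
          simp only [G, if_neg hc] at this
          exact this (Finset.mem_coe.2 (Finset.mem_image.2
            ⟨q', Finset.mem_filter.2 ⟨hq', rfl⟩, h'.symm⟩))

/-! ### Signs in a window -/

/-- The event that the `l` letters from number `r₀` on in the block number `q` of `2 ^ R` letters
have the signs `σ`. -/
def matchSet (C : Set ℕ) (σ : ℕ → Bool) (R r₀ l q : ℕ) : Set (Finset ℕ → Bool) :=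
  {η | ∀ j < l, sign C η (q * 2 ^ R + r₀ + j) = σ j}

/-- The keys of the letters with the numbers `r₀, …, r₀ + l - 1`. -/
def windowKeys (C : Set ℕ) (r₀ l : ℕ) : Finset (Finset ℕ) :=
  (Finset.range l).image fun j => key C (r₀ + j)

theorem mem_matchSet_iff {C : Set ℕ} {η η₀ : Finset ℕ → Bool} {R r₀ l q q₀ : ℕ}
    (hr : r₀ + l ≤ 2 ^ R) :
    η ∈ matchSet C (fun j => sign C η₀ (q₀ * 2 ^ R + r₀ + j)) R r₀ l q ↔
      ∀ a ∈ windowKeys C r₀ l, η (symmDiff a (key C (q * 2 ^ R))) =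
        (η₀ (symmDiff a (key C (q₀ * 2 ^ R))) ^^ par C (q₀ * 2 ^ R) ^^ par C (q * 2 ^ R)) := by
  simp only [matchSet, windowKeys, Set.mem_ofPred_eq, Finset.forall_mem_image, Finset.mem_range]
  refine forall₂_congr fun j hj => ?_
  have h : r₀ + j < 2 ^ R := by omega
  simp only [add_assoc, sign, key_mul_pow_add C _ h, par_mul_pow_add C _ h]
  generalize η _ = x
  generalize η₀ _ = y
  cases x <;> cases y <;> cases par C (r₀ + j) <;> cases par C (q * 2 ^ R) <;>
    cases par C (q₀ * 2 ^ R) <;> simp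

theorem lt_of_mem_key {C : Set ℕ} {R r i : ℕ} (hr : r < 2 ^ R) (hi : i ∈ key C r) : i < R :=
  lt_of_mem_bits hr (mem_key.1 hi).1

theorem le_of_mem_key_mul_pow {C : Set ℕ} {R q i : ℕ} (hi : i ∈ key C (q * 2 ^ R)) : R ≤ i :=
  (mem_bits_mul_pow.1 (mem_key.1 hi).1).1

theorem symmDiff_low_high_injective {R : ℕ} {J : Finset (Finset ℕ)} (hJ : ∀ a ∈ J, ∀ i ∈ a, i < R) :
    Function.Injective fun p : {κ : Finset ℕ // ∀ i ∈ κ, R ≤ i} × J =>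
      symmDiff (p.2 : Finset ℕ) p.1.1 := by
  have key : ∀ (κ : {κ : Finset ℕ // ∀ i ∈ κ, R ≤ i}) (a : J) (i : ℕ),
      (i ∈ a.1 ↔ i < R ∧ i ∈ symmDiff a.1 κ.1) ∧ (i ∈ κ.1 ↔ R ≤ i ∧ i ∈ symmDiff a.1 κ.1) := by
    intro κ a i
    have h1 := hJ a.1 a.2 i
    have h2 := κ.2 i
    rw [Finset.mem_symmDiff]
    constructor
    · refine ⟨fun h => ⟨h1 h, Or.inl ⟨h, fun h' => ?_⟩⟩, ?_⟩
      · exact absurd (h1 h) (not_lt.2 (h2 h'))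
      · rintro ⟨h, h' | h'⟩
        · exact h'.1
        · exact absurd h (not_lt.2 (h2 h'.1))
    · refine ⟨fun h => ⟨h2 h, Or.inr ⟨h, fun h' => ?_⟩⟩, ?_⟩
      · exact absurd (h1 h') (not_lt.2 (h2 h))
      · rintro ⟨h, h' | h'⟩
        · exact absurd (h1 h'.1) (not_lt.2 h)
        · exact h'.1
  rintro ⟨κ, a⟩ ⟨κ', a'⟩ h
  simp only at h
  refine Prod.ext (Subtype.ext (Finset.ext fun i => ?_)) (Subtype.ext (Finset.ext fun i => ?_))
  · rw [(key κ a i).2, (key κ' a' i).2, h]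
  · rw [(key κ a i).1, (key κ' a' i).1, h]

theorem windowKeys_lt {C : Set ℕ} {R r₀ l : ℕ} (hr : r₀ + l ≤ 2 ^ R) :
    ∀ a ∈ windowKeys C r₀ l, ∀ i ∈ a, i < R := by
  intro a ha i hi
  obtain ⟨j, hj, rfl⟩ := Finset.mem_image.1 ha
  exact lt_of_mem_key (by have := Finset.mem_range.1 hj; omega) hi

theorem coins_matchSet {C : Set ℕ} {η₀ : Finset ℕ → Bool} {R r₀ l q q₀ : ℕ}
    (hr : r₀ + l ≤ 2 ^ R) :
    coins.real (matchSet C (fun j => sign C η₀ (q₀ * 2 ^ R + r₀ + j)) R r₀ l q) =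
      2⁻¹ ^ (windowKeys C r₀ l).card := by
  let κ := key C (q * 2 ^ R)
  have hinj : Function.Injective fun a : Finset ℕ => symmDiff a κ := symmDiff_left_injective κ
  have h : matchSet C (fun j => sign C η₀ (q₀ * 2 ^ R + r₀ + j)) R r₀ l q =
      {η | ∀ a ∈ (windowKeys C r₀ l).image fun a => symmDiff a κ,
        η a = (η₀ (symmDiff (symmDiff a κ) (key C (q₀ * 2 ^ R))) ^^ par C (q₀ * 2 ^ R) ^^
          par C (q * 2 ^ R))} := by
    ext η
    rw [mem_matchSet_iff hr]
    simp only [Set.mem_ofPred_eq, Finset.forall_mem_image, symmDiff_symmDiff_cancel_right, κ]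
  rw [h, measureReal_def, coins_forall_eq, Finset.card_image_of_injective _ hinj]
  simp

/-- If the block number `q` is not a copy, with the same signs, of one of the blocks in `S`, then a
match in the block `q` is followed by no match in the blocks in `S` with a probability of almost the
order that independence of all the blocks would give. -/
theorem le_coins_matchSet {C : Set ℕ} {η₀ : Finset ℕ → Bool} {R r₀ l q q₀ : ℕ}
    (hr : r₀ + l ≤ 2 ^ R) (hl : 0 < l) {S : Finset ℕ}
    (hS : ∀ q' ∈ S, key C (q' * 2 ^ R) = key C (q * 2 ^ R) → par C (q' * 2 ^ R) ≠ par C (q * 2 ^ R))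
    {p : ℝ} (hp : p = 2⁻¹ ^ (windowKeys C r₀ l).card) :
    p * √(1 - 2 * p) ^ S.card ≤ coins.real
      {η | η ∈ matchSet C (fun j => sign C η₀ (q₀ * 2 ^ R + r₀ + j)) R r₀ l q ∧ ∀ q' ∈ S,
        η ∉ matchSet C (fun j => sign C η₀ (q₀ * 2 ^ R + r₀ + j)) R r₀ l q'} := by
  let c : ℕ → {κ : Finset ℕ // ∀ i ∈ κ, R ≤ i} := fun q =>
    ⟨key C (q * 2 ^ R), fun i hi => le_of_mem_key_mul_pow hi⟩
  let τ : Bool → windowKeys C r₀ l → Bool := fun b a =>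
    (η₀ (symmDiff a (key C (q₀ * 2 ^ R))) ^^ par C (q₀ * 2 ^ R) ^^ b)
  have hτ : τ true ≠ τ false := fun h => by
    have := congrFun h ⟨key C (r₀ + 0), Finset.mem_image_of_mem _ (Finset.mem_range.2 hl)⟩
    simp [τ] at this
  have hmem : ∀ q η, η ∈ matchSet C (fun j => sign C η₀ (q₀ * 2 ^ R + r₀ + j)) R r₀ l q ↔
      (fun a : windowKeys C r₀ l => η (symmDiff a (c q).1)) = τ (par C (q * 2 ^ R)) := by
    intro q η
    rw [mem_matchSet_iff hr, funext_iff, Subtype.forall]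
  have := le_coins_first_match (f := fun κ a => symmDiff a.1 κ.1)
    (symmDiff_low_high_injective (windowKeys_lt (C := C) hr)) τ hτ c
    (fun q => par C (q * 2 ^ R)) q S (fun q' hq' h => hS q' hq' (Subtype.ext_iff.1 h))
    (hp.trans (by rw [Fintype.card_coe]))
  simpa only [hmem] using this

/-! ### Sets that depend on finitely many letters -/

theorem dependsOn_compl {V : Set Point} {n : ℕ} (hV : DependsOn (· ∈ V) (Set.Iio n)) :
    DependsOn (· ∈ Vᶜ) (Set.Iio n) := fun x y h => by
  have := hV h
  simp only [Set.mem_compl_iff, this]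

theorem mem_iff_of_dependsOn {V : Set Point} {n : ℕ} (hV : DependsOn (· ∈ V) (Set.Iio n))
    {x y : Point} (h : ∀ j < n, x j = y j) : x ∈ V ↔ y ∈ V :=
  iff_of_eq (hV fun j hj => h j hj)

theorem isOpen_of_dependsOn {V : Set Point} {n : ℕ} (hV : DependsOn (· ∈ V) (Set.Iio n)) :
    IsOpen V := by
  rw [isOpen_iff_forall_mem_open]
  intro x hx
  refine ⟨PiNat.cylinder x n, fun y hy => ?_, PiNat.isOpen_cylinder _ x n,
    PiNat.self_mem_cylinder x n⟩
  exact (mem_iff_of_dependsOn hV fun j hj => hy j hj).2 hx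

theorem isClopen_of_dependsOn {V : Set Point} {n : ℕ} (hV : DependsOn (· ∈ V) (Set.Iio n)) :
    IsClopen V :=
  ⟨⟨isOpen_of_dependsOn (dependsOn_compl hV)⟩, isOpen_of_dependsOn hV⟩

theorem measurableSet_of_dependsOn {V : Set Point} {n : ℕ} (hV : DependsOn (· ∈ V) (Set.Iio n)) :
    MeasurableSet V :=
  (isOpen_of_dependsOn hV).measurableSet

theorem measure_ext_of_dependsOn {μ₁ μ₂ : Measure Point} [IsFiniteMeasure μ₁]
    (h : ∀ (n : ℕ) (V : Set Point), DependsOn (· ∈ V) (Set.Iio n) → μ₁ V = μ₂ V) : μ₁ = μ₂ := by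
  refine ext_of_generate_finite _ (generateFrom_measurableCylinders (α := fun _ : ℕ => Fin 3)).symm
    isPiSystem_measurableCylinders (fun V hV => ?_) (h 0 _ fun x y _ => rfl)
  obtain ⟨s, S, -, rfl⟩ := (mem_measurableCylinders V).1 hV
  obtain ⟨n, hn⟩ := s.exists_nat_subset_range
  refine h n _ fun x y hxy => ?_
  have : s.restrict x = s.restrict y :=
    funext fun i => hxy _ (Finset.mem_range.1 (hn i.2))
  simp only [mem_cylinder, this]

/-! ### Cesàro averages -/

theorem measurable_sign (C : Set ℕ) (n : ℕ) : Measurable fun η => sign C η n :=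
  (measurable_of_finite fun b : Bool => (b ^^ par C n)).comp (measurable_pi_apply _)

theorem measurable_point (C : Set ℕ) : Measurable (point C) := by
  refine measurable_pi_lambda _ fun j => ?_
  by_cases h : ∃ n, letterPos n = j
  · obtain ⟨n, rfl⟩ := h
    simp only [point_letterPos]
    exact (measurable_of_finite fun b : Bool => if b then (2 : Fin 3) else 1).comp
      (measurable_sign C n)
  · rw [not_exists] at h
    simp only [point_eq_zero h]
    exact measurable_const

/-- The law of the random sequence `point C η` with fair signs `η`. -/
def pointLaw (C : Set ℕ) : ProbabilityMeasure Point :=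
  ⟨coins.map (point C), Measure.isProbabilityMeasure_map (measurable_point C).aemeasurable⟩

/-- The probability that `V` occurs at the position `i` of the random sequence. -/
def freq (C : Set ℕ) (V : Set Point) (i : ℕ) : ℝ :=
  coins.real {η | shift^[i] (point C η) ∈ V}

theorem freq_nonneg (C : Set ℕ) (V : Set Point) (i : ℕ) : 0 ≤ freq C V i := measureReal_nonneg

theorem freq_le_one (C : Set ℕ) (V : Set Point) (i : ℕ) : freq C V i ≤ 1 := measureReal_le_one

theorem measurable_shift_point (C : Set ℕ) (i : ℕ) : Measurable fun η => shift^[i] (point C η) :=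
  (measurable_shift.iterate i).comp (measurable_point C)

theorem freq_compl {C : Set ℕ} {V : Set Point} (hV : MeasurableSet V) (i : ℕ) :
    freq C Vᶜ i = 1 - freq C V i :=
  probReal_compl_eq_one_sub (measurable_shift_point C i hV)

theorem cesaro_real {C : Set ℕ} {V : Set Point} (hV : MeasurableSet V) (N : ℕ) :
    (cesaro (pointLaw C) N : Measure Point).real V =
      (∑ i ∈ Finset.range (N + 1), freq C V i) / (N + 1 : ℝ) := by
  have h : ∀ i, (((pointLaw C : Measure Point).map (shift^[i])) V).toReal =
      freq C V i := fun i => by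
    rw [Measure.map_apply (measurable_shift.iterate i) hV]
    change (coins.map (point C) _).toReal = _
    rw [Measure.map_apply (measurable_point C) (measurable_shift.iterate i hV)]
    rfl
  change ((((N + 1 : ℕ) : ENNReal)⁻¹ • ∑ i ∈ Finset.range (N + 1),
    (pointLaw C : Measure Point).map (shift^[i])) V).toReal = _
  rw [Measure.smul_apply, Measure.finsetSum_apply, smul_eq_mul, ENNReal.toReal_mul,
    ENNReal.toReal_sum (fun i _ => ?_), Finset.sum_congr rfl fun i _ => h i, ENNReal.toReal_inv,
    ENNReal.toReal_natCast, div_eq_inv_mul]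
  · push_cast; rfl
  · have : IsProbabilityMeasure ((pointLaw C : Measure Point).map (shift^[i])) :=
      Measure.isProbabilityMeasure_map (measurable_shift.iterate i).aemeasurable
    exact measure_ne_top _ _

/-- Occurrences inside a block of `2 ^ R` letters have the same probability in all the blocks. -/
theorem freq_block {C : Set ℕ} {V : Set Point} {n : ℕ} (hV : DependsOn (· ∈ V) (Set.Iio n))
    (q R : ℕ) {i : ℕ} (hi : i + n < 2 ^ (R + 1)) :
    freq C V (letterPos (q * 2 ^ R) + i) = freq C V i := by
  have h : {η | shift^[letterPos (q * 2 ^ R) + i] (point C η) ∈ V} =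
      move C (q * 2 ^ R) ⁻¹' {η | shift^[i] (point C η) ∈ V} := by
    ext η
    refine mem_iff_of_dependsOn hV fun j hj => ?_
    rw [shift_iterate_apply, shift_iterate_apply, add_assoc, point_block C η q R (by omega)]
  rw [freq, h, (measurePreserving_move C _).measureReal_preimage]
  · rfl
  · exact (measurable_shift_point C i (measurableSet_of_dependsOn hV)).nullMeasurableSet

/-- The expected number of occurrences of `V` inside the first block of `2 ^ R` letters, for a set
`V` that depends on the first `n` letters. -/
def blockFreq (C : Set ℕ) (V : Set Point) (n R : ℕ) : ℝ :=
  ∑ i ∈ Finset.range (2 ^ (R + 1) - n), freq C V i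

theorem blockFreq_nonneg (C : Set ℕ) (V : Set Point) (n R : ℕ) : 0 ≤ blockFreq C V n R :=
  Finset.sum_nonneg fun _ _ => freq_nonneg C V _

theorem mul_blockFreq_le {C : Set ℕ} {V : Set Point} {n : ℕ} (hn : 0 < n)
    (hV : DependsOn (· ∈ V) (Set.Iio n)) (Q R : ℕ) :
    Q * blockFreq C V n R ≤ ∑ i ∈ Finset.range (letterPos (Q * 2 ^ R)), freq C V i := by
  induction Q with
  | zero => simp [letterPos]
  | succ Q ih =>
    have h1 : letterPos (Q * 2 ^ R) + (2 ^ (R + 1) - n) ≤ letterPos ((Q + 1) * 2 ^ R) := by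
      have := letterPos_succ_mul_pow Q R
      have : 0 < 2 ^ (R + 1) := by positivity
      omega
    calc ((Q + 1 : ℕ) : ℝ) * blockFreq C V n R = Q * blockFreq C V n R + blockFreq C V n R := by
          push_cast; ring
      _ ≤ ∑ i ∈ Finset.range (letterPos (Q * 2 ^ R)), freq C V i +
          ∑ i ∈ Finset.range (2 ^ (R + 1) - n), freq C V (letterPos (Q * 2 ^ R) + i) := by
        refine add_le_add ih (Finset.sum_congr rfl fun i hi => ?_).le
        have := Finset.mem_range.1 hi
        rw [freq_block hV Q R (by omega)]
      _ = ∑ i ∈ Finset.range (letterPos (Q * 2 ^ R) + (2 ^ (R + 1) - n)), freq C V i :=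
        (Finset.sum_range_add _ _ _).symm
      _ ≤ _ := Finset.sum_le_sum_of_subset_of_nonneg (Finset.range_mono h1)
          fun _ _ _ => freq_nonneg C V _

theorem div_mul_blockFreq_le {C : Set ℕ} {V : Set Point} {n : ℕ} (hn : 0 < n)
    (hV : DependsOn (· ∈ V) (Set.Iio n)) (N R : ℕ) :
    ((N : ℝ) / 2 ^ (R + 1) - 1) * blockFreq C V n R ≤ ∑ i ∈ Finset.range N, freq C V i := by
  have h1 : (N : ℝ) / 2 ^ (R + 1) - 1 ≤ ((N / 2 ^ (R + 1) : ℕ) : ℝ) := by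
    have := Nat.lt_div_mul_add (a := N) (b := 2 ^ (R + 1)) (by positivity)
    rw [sub_le_iff_le_add, div_le_iff₀ (by positivity), add_mul, one_mul]
    exact_mod_cast this.le
  have h2 : letterPos (N / 2 ^ (R + 1) * 2 ^ R) ≤ N := by
    refine (letterPos_le _).trans ?_
    have := Nat.div_mul_le_self N (2 ^ (R + 1))
    rw [pow_succ] at this ⊢
    linarith
  calc _ ≤ ((N / 2 ^ (R + 1) : ℕ) : ℝ) * blockFreq C V n R :=
        mul_le_mul_of_nonneg_right h1 (blockFreq_nonneg C V n R)
    _ ≤ _ := mul_blockFreq_le hn hV _ R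
    _ ≤ _ := Finset.sum_le_sum_of_subset_of_nonneg (Finset.range_mono h2)
          fun _ _ _ => freq_nonneg C V _

theorem tendsto_real_of_dependsOn {ι : Type*} {F : Filter ι} {μs : ι → ProbabilityMeasure Point}
    {μ : ProbabilityMeasure Point} (h : Tendsto μs F (𝓝 μ)) {V : Set Point} {n : ℕ}
    (hV : DependsOn (· ∈ V) (Set.Iio n)) :
    Tendsto (fun i => (μs i : Measure Point).real V) F (𝓝 ((μ : Measure Point).real V)) := by
  have h0 : (μ : Measure Point) (frontier V) = 0 := by
    rw [(isClopen_of_dependsOn hV).frontier_eq, measure_empty]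
  exact (ENNReal.tendsto_toReal (measure_ne_top _ _)).comp
    (ProbabilityMeasure.tendsto_measure_of_null_frontier_of_tendsto' h h0)

theorem blockFreq_le_real {C : Set ℕ} {F : Filter ℕ} [F.NeBot] (hF : F ≤ atTop)
    {μ : ProbabilityMeasure Point} (h : Tendsto (cesaro (pointLaw C)) F (𝓝 μ)) {V : Set Point}
    {n : ℕ} (hn : 0 < n) (hV : DependsOn (· ∈ V) (Set.Iio n)) (R : ℕ) :
    blockFreq C V n R / 2 ^ (R + 1) ≤ (μ : Measure Point).real V := by
  have h1 : Tendsto (fun N : ℕ => (1 / 2 ^ (R + 1) - 1 / ((N : ℝ) + 1)) * blockFreq C V n R) F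
      (𝓝 ((1 / 2 ^ (R + 1) - 0) * blockFreq C V n R)) :=
    ((tendsto_const_nhds.sub tendsto_one_div_add_atTop_nhds_zero_nat).mul_const _).mono_left hF
  rw [show blockFreq C V n R / 2 ^ (R + 1) = (1 / 2 ^ (R + 1) - 0) * blockFreq C V n R by ring]
  refine le_of_tendsto_of_tendsto' h1 (tendsto_real_of_dependsOn h hV) fun N => ?_
  have h2 := div_mul_blockFreq_le (C := C) hn hV (N + 1) R
  have h3 : (0 : ℝ) < (N : ℝ) + 1 := by positivity
  rw [cesaro_real (measurableSet_of_dependsOn hV), le_div_iff₀ h3]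
  refine le_trans (le_of_eq ?_) h2
  push_cast
  field_simp

theorem real_le_blockFreq {C : Set ℕ} {F : Filter ℕ} [F.NeBot] (hF : F ≤ atTop)
    {μ : ProbabilityMeasure Point} (h : Tendsto (cesaro (pointLaw C)) F (𝓝 μ)) {V : Set Point}
    {n : ℕ} (hn : 0 < n) (hV : DependsOn (· ∈ V) (Set.Iio n)) (R : ℕ) :
    (μ : Measure Point).real V ≤ (blockFreq C V n R + n) / 2 ^ (R + 1) := by
  have h1 := blockFreq_le_real hF h hn (dependsOn_compl hV) R
  have h2 : blockFreq C Vᶜ n R = ((2 ^ (R + 1) - n : ℕ) : ℝ) - blockFreq C V n R := by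
    simp [blockFreq, freq_compl (measurableSet_of_dependsOn hV)]
  have h3 : (2 : ℝ) ^ (R + 1) - n ≤ ((2 ^ (R + 1) - n : ℕ) : ℝ) := by
    have : 2 ^ (R + 1) ≤ 2 ^ (R + 1) - n + n := by omega
    have : (2 : ℝ) ^ (R + 1) ≤ ((2 ^ (R + 1) - n : ℕ) : ℝ) + n := by exact_mod_cast this
    linarith
  rw [probReal_compl_eq_one_sub (measurableSet_of_dependsOn hV), h2, div_le_iff₀ (by positivity)]
    at h1
  rw [le_div_iff₀ (by positivity)]
  linarith

theorem eq_of_tendsto_cesaro {C : Set ℕ} {F₁ F₂ : Filter ℕ} [F₁.NeBot] [F₂.NeBot]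
    (hF₁ : F₁ ≤ atTop) (hF₂ : F₂ ≤ atTop) {μ₁ μ₂ : ProbabilityMeasure Point}
    (h₁ : Tendsto (cesaro (pointLaw C)) F₁ (𝓝 μ₁)) (h₂ : Tendsto (cesaro (pointLaw C)) F₂ (𝓝 μ₂)) :
    μ₁ = μ₂ := by
  refine Subtype.ext (measure_ext_of_dependsOn (μ₁ := (μ₁ : Measure Point)) fun n V hV => ?_)
  have hV' : DependsOn (· ∈ V) (Set.Iio (n + 1)) := fun x y h => hV fun i hi =>
    h i (lt_trans hi n.lt_succ_self)
  have hlim : Tendsto (fun R : ℕ => ((n + 1 : ℕ) : ℝ) * (1 / 2) ^ (R + 1)) atTop (𝓝 0) := by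
    have := ((tendsto_pow_atTop_nhds_zero_of_lt_one (r := (1 / 2 : ℝ)) (by norm_num)
      (by norm_num)).comp (tendsto_add_atTop_nat 1)).const_mul (((n + 1 : ℕ) : ℝ))
    simpa using this
  have key : ∀ R, |(μ₁ : Measure Point).real V - (μ₂ : Measure Point).real V| ≤
      ((n + 1 : ℕ) : ℝ) * (1 / 2) ^ (R + 1) := fun R => by
    have a₁ := blockFreq_le_real hF₁ h₁ n.succ_pos hV' R
    have a₂ := blockFreq_le_real hF₂ h₂ n.succ_pos hV' R
    have b₁ := real_le_blockFreq hF₁ h₁ n.succ_pos hV' R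
    have b₂ := real_le_blockFreq hF₂ h₂ n.succ_pos hV' R
    rw [add_div] at b₁ b₂
    have : ((n + 1 : ℕ) : ℝ) * (1 / 2) ^ (R + 1) = ((n + 1 : ℕ) : ℝ) / 2 ^ (R + 1) := by
      rw [one_div, inv_pow]; rfl
    rw [this, abs_le]
    constructor <;> linarith
  have h0 := ge_of_tendsto' hlim key
  have h1 : (μ₁ : Measure Point).real V = (μ₂ : Measure Point).real V :=
    sub_eq_zero.1 (abs_nonpos_iff.1 h0)
  exact (measureReal_eq_measureReal_iff (measure_ne_top (μ₁ : Measure Point) V)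
    (measure_ne_top (μ₂ : Measure Point) V)).1 h1

theorem exists_tendsto_cesaro (C : Set ℕ) :
    ∃ μ : ProbabilityMeasure Point, Tendsto (cesaro (pointLaw C)) atTop (𝓝 μ) := by
  have hex : ∀ U : Ultrafilter ℕ, ∃ μ : ProbabilityMeasure Point,
      Tendsto (cesaro (pointLaw C)) U (𝓝 μ) := fun U =>
    ⟨(U.map (cesaro (pointLaw C))).lim, (U.map (cesaro (pointLaw C))).le_nhds_lim⟩
  obtain ⟨μ, hμ⟩ := hex (Ultrafilter.of atTop)
  refine ⟨μ, tendsto_iff_ultrafilter _ _ _ |>.2 fun U hU => ?_⟩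
  obtain ⟨μ', hμ'⟩ := hex U
  rwa [eq_of_tendsto_cesaro (Ultrafilter.of_le atTop) hU hμ hμ']

theorem measurePreserving_shift_of_tendsto {C : Set ℕ} {μ : ProbabilityMeasure Point}
    (h : Tendsto (cesaro (pointLaw C)) atTop (𝓝 μ)) :
    MeasurePreserving shift (μ : Measure Point) μ := by
  have : IsProbabilityMeasure ((μ : Measure Point).map shift) :=
    Measure.isProbabilityMeasure_map measurable_shift.aemeasurable
  refine ⟨measurable_shift, measure_ext_of_dependsOn fun n V hV => ?_⟩
  have hm := measurableSet_of_dependsOn hV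
  have hV' : DependsOn (· ∈ shift ⁻¹' V) (Set.Iio (n + 1)) := fun x y h => hV fun i hi =>
    h (i + 1) (Nat.succ_lt_succ hi)
  rw [Measure.map_apply measurable_shift hm]
  refine (measureReal_eq_measureReal_iff).1 (sub_eq_zero.1 ?_)
  have h1 := (tendsto_real_of_dependsOn h hV').sub (tendsto_real_of_dependsOn h hV)
  refine tendsto_nhds_unique h1 ?_
  refine squeeze_zero_norm (fun N => ?_) tendsto_one_div_add_atTop_nhds_zero_nat
  have hs : ∀ i, freq C (shift ⁻¹' V) i = freq C V (i + 1) := fun i => by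
    simp only [freq, Function.iterate_succ_apply', Set.mem_preimage]
  rw [cesaro_real hm, cesaro_real (measurable_shift hm), Finset.sum_congr rfl fun i _ => hs i,
    ← sub_div, ← Finset.sum_sub_distrib, Finset.sum_range_sub (freq C V), norm_div,
    Real.norm_eq_abs, Real.norm_eq_abs, abs_of_pos (by positivity : (0 : ℝ) < (N : ℝ) + 1)]
  refine div_le_div_of_nonneg_right ?_ (by positivity)
  have b1 := freq_nonneg C V (N + 1)
  have b2 := freq_le_one C V (N + 1)
  have b3 := freq_nonneg C V 0
  have b4 := freq_le_one C V 0
  rw [abs_le]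
  constructor <;> linarith

/-! ### Points that are eventually `0` -/

/-- A block of `2 ^ R` letters contains no `R + 1` zeros in a row. -/
theorem exists_letterPos_mem (R : ℕ) {i : ℕ} (hi : i + (R + 1) < 2 ^ (R + 1)) :
    ∃ j < R + 1, ∃ m, letterPos m = i + j := by
  have hex : ∃ m, i ≤ letterPos m := ⟨2 ^ R, by have := letterPos_two_pow R; omega⟩
  have h1 : i ≤ letterPos (Nat.find hex) := Nat.find_spec hex
  have h2 : Nat.find hex ≤ 2 ^ R := Nat.find_min' hex (by have := letterPos_two_pow R; omega)
  refine ⟨letterPos (Nat.find hex) - i, ?_, Nat.find hex, by omega⟩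
  rcases Nat.eq_zero_or_pos (Nat.find hex) with h0 | h0
  · rw [h0]; simp [letterPos]
  · obtain ⟨k, hk⟩ := Nat.exists_eq_succ_of_ne_zero h0.ne'
    have h3 : letterPos k < i := not_le.1 (Nat.find_min hex (by omega))
    rw [hk] at h2 ⊢
    have h4 : 2 ^ omega (k + 1) ≤ 2 ^ R :=
      (Nat.le_of_dvd k.succ_pos (pow_dvd_of_le_omega le_rfl)).trans h2
    have h5 : omega (k + 1) ≤ R := (Nat.pow_le_pow_iff_right (by norm_num)).1 h4
    have := letterPos_succ k
    simp only [Nat.succ_eq_add_one]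
    omega

theorem measure_zero_eq_zero {C : Set ℕ} {μ : ProbabilityMeasure Point}
    (h : Tendsto (cesaro (pointLaw C)) atTop (𝓝 μ)) : (μ : Measure Point) {fun _ => 0} = 0 := by
  have hlim : Tendsto (fun R : ℕ => (((R + 1 : ℕ) : ℝ)) * (1 / 2) ^ (R + 1)) atTop (𝓝 0) :=
    (tendsto_self_mul_const_pow_of_lt_one (r := (1 / 2 : ℝ)) (by norm_num) (by norm_num)).comp
      (tendsto_add_atTop_nat 1)
  have key : ∀ R : ℕ, (μ : Measure Point).real {fun _ => 0} ≤
      ((R + 1 : ℕ) : ℝ) * (1 / 2) ^ (R + 1) := fun R => by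
    let V : Set Point := {y | ∀ j < R + 1, y j = 0}
    have hV : DependsOn (· ∈ V) (Set.Iio (R + 1)) := fun x y hxy =>
      propext (forall₂_congr fun j hj => by rw [hxy j hj])
    have h1 := real_le_blockFreq le_rfl h R.succ_pos hV R
    have h2 : blockFreq C V (R + 1) R = 0 := Finset.sum_eq_zero fun i hi => by
      have hi' := Finset.mem_range.1 hi
      obtain ⟨j, hj, m, hm⟩ := exists_letterPos_mem R (i := i) (by omega)
      have : {η | shift^[i] (point C η) ∈ V} = ∅ := Set.eq_empty_of_forall_notMem fun η hη => by
        have := hη j hj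
        rw [shift_iterate_apply] at this
        exact point_ne_zero_iff.2 ⟨m, hm⟩ this
      rw [freq, this, measureReal_empty]
    calc _ ≤ (μ : Measure Point).real V := measureReal_mono (by
          rintro y rfl j -; rfl)
      _ ≤ _ := by
        refine h1.trans (le_of_eq ?_)
        rw [h2, one_div, inv_pow]; simp [div_eq_mul_inv]
  have h0 := ge_of_tendsto' hlim key
  exact (measureReal_eq_zero_iff).1 (le_antisymm h0 measureReal_nonneg)

theorem measure_compl_goodPoints {C : Set ℕ} {μ : ProbabilityMeasure Point}
    (h : Tendsto (cesaro (pointLaw C)) atTop (𝓝 μ)) :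
    (μ : Measure Point) (goodPoints μ)ᶜ = 0 := by
  have hT := measurePreserving_shift_of_tendsto h
  rw [goodPoints, Set.compl_sdiff, measure_union_null_iff, measure_iUnion_null_iff]
  refine ⟨fun i => ?_, Measure.measure_compl_support⟩
  rw [(hT.iterate i).measure_preimage (measurableSet_singleton _).nullMeasurableSet]
  exact measure_zero_eq_zero h

/-! ### Returns to a cylinder -/

/-- The set of the points that do not visit `B` at the times `1, …, K`. -/
def noReturn (B : Set Point) (K : ℕ) : Set Point :=
  {y | ∀ k, 1 ≤ k → k ≤ K → shift^[k] y ∉ B}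

theorem measurableSet_noReturn {B : Set Point} (hB : MeasurableSet B) (K : ℕ) :
    MeasurableSet (noReturn B K) := by
  have : noReturn B K = ⋂ k, ⋂ (_ : 1 ≤ k), ⋂ (_ : k ≤ K), (shift^[k] ⁻¹' B)ᶜ := by
    ext y; simp [noReturn]
  rw [this]
  exact MeasurableSet.iInter fun k => MeasurableSet.iInter fun _ => MeasurableSet.iInter fun _ =>
    (measurable_shift.iterate k hB).compl

theorem dependsOn_noReturn {B : Set Point} {n : ℕ} (hB : DependsOn (· ∈ B) (Set.Iio n)) (K : ℕ) :
    DependsOn (· ∈ B ∩ noReturn B K) (Set.Iio (K + n)) := fun x y h => by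
  have h' : ∀ k ≤ K, shift^[k] x ∈ B ↔ shift^[k] y ∈ B := fun k hk =>
    mem_iff_of_dependsOn hB fun j hj => by
      rw [shift_iterate_apply, shift_iterate_apply]
      exact h _ (by simp only [Set.mem_Iio]; omega)
  refine propext (and_congr (h' 0 (Nat.zero_le _)) ?_)
  exact forall_congr' fun k => imp_congr_right fun _ => forall_congr' fun hk =>
    not_congr (h' k hk)

theorem letterPos_add_mul_le (q j R : ℕ) :
    letterPos (q * 2 ^ R) + j * (2 ^ (R + 1) - 1) ≤ letterPos ((q + j) * 2 ^ R) := by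
  induction j with
  | zero => simp
  | succ j ih =>
    have := letterPos_succ_mul_pow (q + j) R
    have h2 : 0 < 2 ^ (R + 1) := by positivity
    rw [← add_assoc, add_mul (j : ℕ) 1, one_mul]
    omega

/-- The shifts of the sequences `point C η` lie in `B` exactly `s` positions before the letters with
the numbers `q * 2 ^ R + r₀` from which on `l` letters have the signs `σ`. The window of these
letters lies in the block number `q` of `2 ^ R` letters, and some sequence has the signs `σ`
there. -/
structure IsWindow (C : Set ℕ) (B : Set Point) (σ : ℕ → Bool) (R r₀ l s : ℕ) : Prop where
  window_le : r₀ + l ≤ 2 ^ R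
  pos : 0 < l
  zeros_le : s ≤ R
  mem_iff : ∀ η i, shift^[i] (point C η) ∈ B ↔
    ∃ q, i + s = letterPos (q * 2 ^ R + r₀) ∧ η ∈ matchSet C σ R r₀ l q
  sign_eq : ∃ η₀ q₀, σ = fun j => sign C η₀ (q₀ * 2 ^ R + r₀ + j)

section Window

variable {C : Set ℕ} {B : Set Point} {σ : ℕ → Bool} {R r₀ l s n : ℕ} {p : ℝ}
  {μ : ProbabilityMeasure Point}

theorem IsWindow.letterPos_mul_add (h : IsWindow C B σ R r₀ l s) (q : ℕ) :
    letterPos (q * 2 ^ R + r₀) = letterPos (q * 2 ^ R) + letterPos r₀ :=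
  letterPos_mul_pow_add q R (by have := h.window_le; have := h.pos; omega)

theorem IsWindow.zeros_le_letterPos (h : IsWindow C B σ R r₀ l s) {q : ℕ} (hq : q ≠ 0) :
    s ≤ letterPos (q * 2 ^ R + r₀) := by
  have h2 : R < 2 ^ R := R.lt_two_pow_self
  have h3 : 1 * 2 ^ R ≤ q * 2 ^ R := Nat.mul_le_mul_right _ (by omega)
  have h4 := letterPos_add_le 0 (q * 2 ^ R + r₀)
  rw [zero_add] at h4
  have := h.zeros_le
  omega

theorem IsWindow.real_le (h : IsWindow C B σ R r₀ l s) (hB : DependsOn (· ∈ B) (Set.Iio n))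
    (hp : p = 2⁻¹ ^ (windowKeys C r₀ l).card) (hμ : Tendsto (cesaro (pointLaw C)) atTop (𝓝 μ)) :
    (μ : Measure Point).real B ≤ p / (2 ^ (R + 1) - 1) := by
  obtain ⟨d, hd, hd0⟩ : ∃ d : ℕ, d = 2 ^ (R + 1) - 1 ∧ 0 < d := ⟨_, rfl, by
    have : 2 ^ 1 ≤ 2 ^ (R + 1) := Nat.pow_le_pow_right (by norm_num) (by omega)
    omega⟩
  have hdr : (2 : ℝ) ^ (R + 1) - 1 = d := by
    rw [hd, Nat.cast_sub Nat.one_le_two_pow]; simp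
  have hd0' : (0 : ℝ) < d := by exact_mod_cast hd0
  have hp0 : 0 ≤ p := by rw [hp]; positivity
  have hle : ∀ i, freq C B i ≤ p := fun i => by
    by_cases hq : ∃ q, i + s = letterPos (q * 2 ^ R + r₀)
    · obtain ⟨q, hq⟩ := hq
      obtain ⟨η₀, q₀, hσ⟩ := h.sign_eq
      rw [hp, ← coins_matchSet (η₀ := η₀) (q₀ := q₀) (q := q) h.window_le, ← hσ]
      refine measureReal_mono fun η hη => ?_
      obtain ⟨q', hq', hm⟩ := (h.mem_iff η i).1 hη
      have h1 := letterPos_strictMono.injective (hq.symm.trans hq')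
      have h2 : q = q' := Nat.eq_of_mul_eq_mul_right (by positivity : 0 < 2 ^ R) (by omega)
      rwa [h2]
    · have : {η | shift^[i] (point C η) ∈ B} = ∅ := Set.eq_empty_of_forall_notMem fun η hη => by
        obtain ⟨q, hq', -⟩ := (h.mem_iff η i).1 hη
        exact hq ⟨q, hq'⟩
      rw [freq, this, measureReal_empty]
      exact hp0
  have hsum : ∀ N : ℕ, ∑ i ∈ Finset.range N, freq C B i ≤ ((N + s : ℝ) / d + 1) * p := fun N => by
    let A := (Finset.range ((N + s) / d + 1)).image fun q => letterPos (q * 2 ^ R + r₀) - s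
    have hA : ∀ i ∈ Finset.range N, i ∉ A → freq C B i = 0 := fun i hi hiA => by
      have : {η | shift^[i] (point C η) ∈ B} = ∅ := Set.eq_empty_of_forall_notMem fun η hη => by
        obtain ⟨q, hq, -⟩ := (h.mem_iff η i).1 hη
        refine hiA (Finset.mem_image.2 ⟨q, Finset.mem_range.2 ?_, by omega⟩)
        have h1 := mul_le_letterPos q R
        rw [h.letterPos_mul_add] at hq
        have := Finset.mem_range.1 hi
        rw [← hd] at h1
        exact Nat.lt_succ_of_le ((Nat.le_div_iff_mul_le hd0).2 (by omega))
      rw [freq, this, measureReal_empty]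
    calc ∑ i ∈ Finset.range N, freq C B i = ∑ i ∈ (Finset.range N).filter (· ∈ A), freq C B i := by
          rw [Finset.sum_filter]
          exact Finset.sum_congr rfl fun i hi => by
            split_ifs with hiA
            · rfl
            · exact hA i hi hiA
      _ ≤ ∑ i ∈ (Finset.range N).filter (· ∈ A), p := Finset.sum_le_sum fun i _ => hle i
      _ = ((Finset.range N).filter (· ∈ A)).card * p := by simp
      _ ≤ _ := by
        refine mul_le_mul_of_nonneg_right ?_ hp0
        have h1 : ((Finset.range N).filter (· ∈ A)).card ≤ (N + s) / d + 1 :=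
          (Finset.card_le_card fun i hi => (Finset.mem_filter.1 hi).2).trans
            (Finset.card_image_le.trans (by simp))
        have h2 : (((N + s) / d + 1 : ℕ) : ℝ) ≤ (N + s : ℝ) / d + 1 := by
          push_cast
          have := Nat.cast_div_le (α := ℝ) (m := N + s) (n := d)
          push_cast at this
          linarith
        exact le_trans (by exact_mod_cast h1) h2
  have hlim : Tendsto (fun N : ℕ => p / d + (1 / ((N : ℝ) + 1)) * ((s / d + 1) * p)) atTop
      (𝓝 (p / d + 0 * ((s / d + 1) * p))) :=
    (tendsto_one_div_add_atTop_nhds_zero_nat.mul_const _).const_add _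
  rw [hdr, show p / d = p / d + 0 * ((s / d + 1) * p) by ring]
  refine le_of_tendsto_of_tendsto' (tendsto_real_of_dependsOn hμ hB) hlim fun N => ?_
  have h3 : (0 : ℝ) < (N : ℝ) + 1 := by positivity
  rw [cesaro_real (measurableSet_of_dependsOn hB), div_le_iff₀ h3]
  refine (hsum (N + 1)).trans (le_of_eq ?_)
  push_cast
  field_simp
  ring

/-- A lower bound for the probability that a visit to `B` in the block number `q` is followed by no
visit at the next `K` times, which lie in the next `m` blocks. -/
theorem IsWindow.le_freq (h : IsWindow C B σ R r₀ l s)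
    (hp : p = 2⁻¹ ^ (windowKeys C r₀ l).card) {q K m : ℕ} (hq : q ≠ 0)
    (hm : m = K / (2 ^ (R + 1) - 1))
    (hgood : ∀ q', q < q' → q' ≤ q + m → key C (q' * 2 ^ R) = key C (q * 2 ^ R) →
      par C (q' * 2 ^ R) ≠ par C (q * 2 ^ R)) :
    p * √(1 - 2 * p) ^ m ≤ freq C (B ∩ noReturn B K) (letterPos (q * 2 ^ R + r₀) - s) := by
  obtain ⟨η₀, q₀, hσ⟩ := h.sign_eq
  have h1 := le_coins_matchSet (η₀ := η₀) (q := q) (q₀ := q₀) h.window_le h.pos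
    (S := Finset.Ioc q (q + m))
    (fun q' hq' => hgood q' (Finset.mem_Ioc.1 hq').1 (Finset.mem_Ioc.1 hq').2) hp
  rw [← hσ, Nat.card_Ioc, Nat.add_sub_cancel_left] at h1
  refine h1.trans (measureReal_mono fun η hη => ?_)
  have hs := h.zeros_le_letterPos hq
  refine ⟨(h.mem_iff η _).2 ⟨q, by omega, hη.1⟩, fun k hk1 hkK hk => ?_⟩
  rw [← Function.iterate_add_apply, h.mem_iff] at hk
  obtain ⟨q', hq', hmatch⟩ := hk
  have hlt : q * 2 ^ R + r₀ < q' * 2 ^ R + r₀ := letterPos_strictMono.lt_iff_lt.1 (by omega)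
  have hlt' : q < q' := lt_of_mul_lt_mul_right (by omega : q * 2 ^ R < q' * 2 ^ R) (Nat.zero_le _)
  refine hη.2 q' (Finset.mem_Ioc.2 ⟨hlt', ?_⟩) hmatch
  obtain ⟨j, rfl⟩ := Nat.exists_eq_add_of_lt hlt'
  have h5 := letterPos_add_mul_le q (j + 1) R
  rw [h.letterPos_mul_add] at hq' hs
  rw [h.letterPos_mul_add] at hq'
  have h6 : j + 1 ≤ m := by
    rw [hm, Nat.le_div_iff_mul_le]
    · rw [← add_assoc] at h5; omega
    · have : 2 ^ 1 ≤ 2 ^ (R + 1) := Nat.pow_le_pow_right (by norm_num) (by omega)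
      omega
  omega

/-- A lower bound for the probability of a visit to `B` that is followed by no visit at the next `K`
times. If the blocks that are copies with the same signs do not lie in the same group of `D` blocks,
then the blocks with such a copy among the next `m` blocks have a density of at most `m / D`. -/
theorem IsWindow.le_real (h : IsWindow C B σ R r₀ l s) (hB : DependsOn (· ∈ B) (Set.Iio n))
    (hp : p = 2⁻¹ ^ (windowKeys C r₀ l).card) (hμ : Tendsto (cesaro (pointLaw C)) atTop (𝓝 μ))
    {D : ℕ} (hD0 : 0 < D)
    (hD : ∀ q q', q < q' → key C (q' * 2 ^ R) = key C (q * 2 ^ R) →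
      par C (q' * 2 ^ R) = par C (q * 2 ^ R) → q / D ≠ q' / D) (K : ℕ) {m : ℕ}
    (hm : m = K / (2 ^ (R + 1) - 1)) :
    p / 2 ^ (R + 1) * ((1 - m / D) * √(1 - 2 * p) ^ m) ≤
      (μ : Measure Point).real (B ∩ noReturn B K) := by
  set c := p * √(1 - 2 * p) ^ m with hc
  have hc0 : 0 ≤ c := mul_nonneg (by rw [hp]; positivity) (pow_nonneg (Real.sqrt_nonneg _) _)
  have hV := dependsOn_noReturn hB K
  set V := B ∩ noReturn B K
  have hsum : ∀ J : ℕ, ((J : ℝ) * (D - m : ℕ) - 1) * c ≤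
      ∑ i ∈ Finset.range (J * D * 2 ^ (R + 1)), freq C V i := fun J => by
    let good := (Finset.range (J * D)).filter fun q => q % D < D - m
    let f : ℕ → ℕ := fun q => letterPos (q * 2 ^ R + r₀) - s
    have hcard : J * (D - m) ≤ good.card := by
      rw [← Finset.card_range J, ← Finset.card_range (D - m), ← Finset.card_product]
      have hlt : ∀ {e}, e < D - m → e < D := fun he => by omega
      have hmod : ∀ {a e}, e < D → (a * D + e) % D = e := fun {a e} he => by
        rw [Nat.mul_add_mod', Nat.mod_eq_of_lt he]
      refine Finset.card_le_card_of_injOn (fun x => x.1 * D + x.2) (fun x hx => ?_) ?_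
      · obtain ⟨h1, h2⟩ := Finset.mem_product.1 (Finset.mem_coe.1 hx)
        rw [Finset.mem_range] at h1 h2
        refine Finset.mem_coe.2 (Finset.mem_filter.2 ⟨Finset.mem_range.2 ?_, ?_⟩)
        · calc x.1 * D + x.2 < x.1 * D + D := by have := hlt h2; omega
            _ = (x.1 + 1) * D := by ring
            _ ≤ _ := Nat.mul_le_mul_right _ h1
        · rw [hmod (hlt h2)]; exact h2
      · intro x hx y hy hxy
        obtain ⟨-, h2⟩ := Finset.mem_product.1 (Finset.mem_coe.1 hx)
        obtain ⟨-, h4⟩ := Finset.mem_product.1 (Finset.mem_coe.1 hy)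
        rw [Finset.mem_range] at h2 h4
        simp only at hxy
        have h5 : x.2 = y.2 := by rw [← hmod (a := x.1) (hlt h2), hxy, hmod (hlt h4)]
        rw [h5] at hxy
        exact Prod.ext (Nat.eq_of_mul_eq_mul_right hD0 (by omega)) h5
    have hinj : Set.InjOn f (good.erase 0) := by
      intro q hq q' hq' hqq
      have h1 := h.zeros_le_letterPos (Finset.mem_erase.1 (Finset.mem_coe.1 hq)).1
      have h2 := h.zeros_le_letterPos (Finset.mem_erase.1 (Finset.mem_coe.1 hq')).1
      have h3 : letterPos (q * 2 ^ R + r₀) = letterPos (q' * 2 ^ R + r₀) := by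
        simp only [f] at hqq; omega
      have h4 := letterPos_strictMono.injective h3
      exact Nat.eq_of_mul_eq_mul_right (by positivity : 0 < 2 ^ R) (by omega)
    have hsub : (good.erase 0).image f ⊆ Finset.range (J * D * 2 ^ (R + 1)) := fun i hi => by
      obtain ⟨q, hq, rfl⟩ := Finset.mem_image.1 hi
      have h1 := Finset.mem_range.1 (Finset.mem_filter.1 (Finset.mem_erase.1 hq).2).1
      have h2 := letterPos_le (q * 2 ^ R + r₀)
      have h3 : (q + 1) * 2 ^ R ≤ J * D * 2 ^ R := Nat.mul_le_mul_right _ h1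
      have h4 := h.window_le
      have h5 := h.pos
      rw [Finset.mem_range, pow_succ, ← mul_assoc]
      rw [add_mul] at h3
      simp only [f]
      omega
    have hge : ∀ q ∈ good.erase 0, c ≤ freq C V (f q) := fun q hq => by
      obtain ⟨hq0, hq⟩ := Finset.mem_erase.1 hq
      have hqm := (Finset.mem_filter.1 hq).2
      refine h.le_freq hp hq0 hm fun q' h1 h2 h3 h4 => hD q q' h1 h3 h4 ?_
      have h5 := Nat.div_add_mod q D
      refine (Nat.div_eq_of_lt_le ?_ ?_).symm
      · rw [mul_comm]; omega
      · rw [add_mul, mul_comm]; omega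
    calc ((J : ℝ) * (D - m : ℕ) - 1) * c ≤ (good.erase 0).card * c := by
          refine mul_le_mul_of_nonneg_right ?_ hc0
          have h1 := Finset.pred_card_le_card_erase (s := good) (a := 0)
          have h2 : J * (D - m) ≤ (good.erase 0).card + 1 := by omega
          rw [sub_le_iff_le_add]
          exact_mod_cast h2
      _ = ∑ q ∈ good.erase 0, c := by simp
      _ ≤ ∑ q ∈ good.erase 0, freq C V (f q) := Finset.sum_le_sum hge
      _ = ∑ i ∈ (good.erase 0).image f, freq C V i := (Finset.sum_image hinj).symm
      _ ≤ _ := Finset.sum_le_sum_of_subset_of_nonneg hsub fun _ _ _ => freq_nonneg C V _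
  have hDr : (0 : ℝ) < D := by exact_mod_cast hD0
  let φ : ℕ → ℕ := fun J => (J + 1) * D * 2 ^ (R + 1) - 1
  have hφ1 : ∀ J, φ J + 1 = (J + 1) * D * 2 ^ (R + 1) := fun J =>
    Nat.sub_add_cancel (Nat.one_le_iff_ne_zero.2 (by positivity))
  have hφ : Tendsto φ atTop atTop := by
    refine tendsto_atTop_mono (fun J => ?_) tendsto_id
    have h1 : (J + 1) * 1 ≤ (J + 1) * (D * 2 ^ (R + 1)) :=
      Nat.mul_le_mul_left _ (Nat.one_le_iff_ne_zero.2 (by positivity))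
    have h2 := hφ1 J
    rw [mul_assoc] at h2
    simp only [id]
    omega
  have hlim : Tendsto (fun J : ℕ => ((D - m : ℕ) / (D : ℝ) - 1 / ((J : ℝ) + 1) * (1 / D)) *
      (c / 2 ^ (R + 1))) atTop
      (𝓝 (((D - m : ℕ) / (D : ℝ) - 0 * (1 / D)) * (c / 2 ^ (R + 1)))) :=
    ((tendsto_one_div_add_atTop_nhds_zero_nat.mul_const _).const_sub _).mul_const _
  have hge := le_of_tendsto_of_tendsto' hlim ((tendsto_real_of_dependsOn hμ hV).comp hφ)
    fun J => by
      have h1 := hsum (J + 1)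
      have h2 : ((φ J : ℕ) : ℝ) + 1 = ((J : ℝ) + 1) * D * 2 ^ (R + 1) := by exact_mod_cast hφ1 J
      simp only [Function.comp_apply]
      rw [cesaro_real (measurableSet_of_dependsOn hV), hφ1, h2, le_div_iff₀ (by positivity)]
      refine le_trans (le_of_eq ?_) h1
      push_cast
      field_simp
  refine le_trans ?_ hge
  have h3 : (1 : ℝ) - m / D ≤ (D - m : ℕ) / (D : ℝ) - 0 * (1 / D) := by
    have : (D : ℝ) ≤ (D - m : ℕ) + m := by
      exact_mod_cast (show D ≤ D - m + m by omega)
    rw [zero_mul, sub_zero, le_div_iff₀ hDr, sub_mul, one_mul, div_mul_cancel₀ _ hDr.ne']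
    linarith
  calc p / 2 ^ (R + 1) * ((1 - m / D) * √(1 - 2 * p) ^ m) = (1 - m / D) * (c / 2 ^ (R + 1)) := by
        rw [hc]; ring
    _ ≤ _ := mul_le_mul_of_nonneg_right h3 (by positivity)

end Window

/-! ### Flip positions -/

/-- The binary logarithm of the number `2 b_1 ⋯ 2 b_k` of nonzero letters in the words of the `k`-th
family. -/
def level (b : ℕ → ℕ) (k : ℕ) : ℕ := ∑ i ∈ Finset.Icc 1 k, (Nat.log 2 (b i) + 1)

/-- The position of the binary digit that tells the second half of a word of the family number
`k + 1`, which is reversed, from the first one. -/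
def flipPos (b : ℕ → ℕ) (k : ℕ) : ℕ := level b k + Nat.log 2 (b (k + 1))

/-- The set of all flip positions. -/
def flips (b : ℕ → ℕ) : Set ℕ := Set.range (flipPos b)

theorem level_succ (b : ℕ → ℕ) (k : ℕ) : level b (k + 1) = flipPos b k + 1 := by
  rw [level, Finset.sum_Icc_succ_top (by omega), flipPos, level, add_assoc]

theorem flipPos_strictMono (b : ℕ → ℕ) : StrictMono (flipPos b) :=
  strictMono_nat_of_lt_succ fun k => by
    have := level_succ b k
    rw [flipPos.eq_1 b (k + 1)]; omega

theorem flipPos_lt_level_iff {b : ℕ → ℕ} {j k : ℕ} : flipPos b j < level b k ↔ j < k := by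
  rcases k with _ | k
  · simp [level]
  · rw [level_succ, Nat.lt_succ_iff, Nat.lt_succ_iff, (flipPos_strictMono b).le_iff_le]

open Classical in
/-- Below the level `k` there are exactly `k` flip positions. -/
theorem card_filter_notMem_flips (b : ℕ → ℕ) (k : ℕ) :
    ((Finset.range (level b k)).filter (· ∉ flips b)).card =
      ∑ i ∈ Finset.Icc 1 k, Nat.log 2 (b i) := by
  have h1 : (Finset.range (level b k)).filter (· ∈ flips b) =
      (Finset.range k).image (flipPos b) := by
    ext i
    simp only [Finset.mem_filter, Finset.mem_range, Finset.mem_image, flips, Set.mem_range]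
    constructor
    · rintro ⟨h, j, rfl⟩
      exact ⟨j, flipPos_lt_level_iff.1 h, rfl⟩
    · rintro ⟨j, h, rfl⟩
      exact ⟨flipPos_lt_level_iff.2 h, j, rfl⟩
  have h2 := Finset.card_filter_add_card_filter_not (s := Finset.range (level b k)) (· ∈ flips b)
  rw [h1, Finset.card_image_of_injective _ (flipPos_strictMono b).injective, Finset.card_range,
    Finset.card_range] at h2
  have h3 : level b k = ∑ i ∈ Finset.Icc 1 k, Nat.log 2 (b i) + k := by
    rw [level, Finset.sum_add_distrib]; simp
  omega

theorem two_pow_log {b : ℕ → ℕ} (hpow : ∀ n : ℕ, 1 ≤ n → ∃ j : ℕ, b n = 2 ^ j) {i : ℕ}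
    (hi : 1 ≤ i) : 2 ^ Nat.log 2 (b i) = b i := by
  obtain ⟨j, hj⟩ := hpow i hi
  rw [hj, Nat.log_pow (by norm_num)]

theorem two_pow_sum_log {b : ℕ → ℕ} (hpow : ∀ n : ℕ, 1 ≤ n → ∃ j : ℕ, b n = 2 ^ j) (k : ℕ) :
    2 ^ ∑ i ∈ Finset.Icc 1 k, Nat.log 2 (b i) = ∏ i ∈ Finset.Icc 1 k, b i := by
  rw [← Finset.prod_pow_eq_pow_sum]
  exact Finset.prod_congr rfl fun i hi => two_pow_log hpow (Finset.mem_Icc.1 hi).1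

/-- Two blocks of `2 ^ R` letters with the same free signs and the same parity differ in at least
two digits at flip positions, hence they are far apart. -/
theorem div_ne_div_of_key_eq {b : ℕ → ℕ} {R k q q' : ℕ} (hk : R ≤ flipPos b k)
    (hk' : ∀ j < k, flipPos b j < R) (hne : q ≠ q')
    (hkey : key (flips b) (q' * 2 ^ R) = key (flips b) (q * 2 ^ R))
    (hpar : par (flips b) (q' * 2 ^ R) = par (flips b) (q * 2 ^ R)) :
    q / 2 ^ (flipPos b (k + 1) - R) ≠ q' / 2 ^ (flipPos b (k + 1) - R) := by
  classical
  intro hdiv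
  have hlt := flipPos_strictMono b (Nat.lt_succ_self k)
  simp only [Nat.succ_eq_add_one] at hlt
  have hhigh : ∀ i, flipPos b (k + 1) ≤ i → (i ∈ bits (q * 2 ^ R) ↔ i ∈ bits (q' * 2 ^ R)) := by
    intro i hi
    have h1 : ∀ n : ℕ, n.testBit (i - R) =
        (n / 2 ^ (flipPos b (k + 1) - R)).testBit (i - flipPos b (k + 1)) := fun n => by
      rw [Nat.testBit_div_two_pow]; congr 1; omega
    rw [mem_bits_mul_pow, mem_bits_mul_pow, mem_bits, mem_bits, h1 q, h1 q', hdiv]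
  have hother : ∀ i, i ≠ flipPos b k → (i ∈ bits (q * 2 ^ R) ↔ i ∈ bits (q' * 2 ^ R)) := by
    intro i hi
    by_cases hC : i ∈ flips b
    · obtain ⟨j, rfl⟩ := hC
      rcases lt_trichotomy j k with h | rfl | h
      · have := hk' j h
        rw [mem_bits_mul_pow, mem_bits_mul_pow]
        constructor <;> intro h' <;> omega
      · exact absurd rfl hi
      · exact hhigh _ ((flipPos_strictMono b).monotone h)
    · have h1 : i ∈ key (flips b) (q * 2 ^ R) ↔ i ∈ key (flips b) (q' * 2 ^ R) := by rw [hkey]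
      rw [mem_key, mem_key] at h1
      tauto
  have hmain : flipPos b k ∈ bits (q * 2 ^ R) ↔ flipPos b k ∈ bits (q' * 2 ^ R) := by
    have hC : flipPos b k ∈ flips b := ⟨k, rfl⟩
    set S := (bits (q * 2 ^ R)).filter (· ∈ flips b) with hS
    set S' := (bits (q' * 2 ^ R)).filter (· ∈ flips b) with hS'
    have hm : flipPos b k ∈ bits (q * 2 ^ R) ↔ flipPos b k ∈ S := by
      rw [hS, Finset.mem_filter, and_iff_left hC]
    have hm' : flipPos b k ∈ bits (q' * 2 ^ R) ↔ flipPos b k ∈ S' := by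
      rw [hS', Finset.mem_filter, and_iff_left hC]
    have herase : S.erase (flipPos b k) = S'.erase (flipPos b k) := by
      ext i
      rw [Finset.mem_erase, Finset.mem_erase, hS, hS', Finset.mem_filter, Finset.mem_filter]
      refine and_congr_right fun hi => and_congr_left fun _ => hother i hi
    have hpar' : S'.card.bodd = S.card.bodd := by
      unfold par at hpar
      convert hpar
    rw [hm, hm']
    by_contra hcon
    rcases Classical.em (flipPos b k ∈ S) with h | h
    · have h' : flipPos b k ∉ S' := fun h' => hcon ⟨fun _ => h', fun _ => h⟩
      rw [Finset.erase_eq_of_notMem h'] at herase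
      rw [← Finset.card_erase_add_one h, herase, Nat.bodd_succ] at hpar'
      revert hpar'; cases S'.card.bodd <;> simp
    · have h' : flipPos b k ∈ S' := by
        by_contra h'; exact hcon ⟨fun a => absurd a h, fun a => absurd a h'⟩
      rw [Finset.erase_eq_of_notMem h] at herase
      rw [← Finset.card_erase_add_one h', ← herase, Nat.bodd_succ] at hpar'
      revert hpar'; cases S.card.bodd <;> simp
  refine hne (Nat.eq_of_mul_eq_mul_right (by positivity : 0 < 2 ^ R) (bits_injective ?_))
  ext i
  by_cases hi : i = flipPos b k
  · rw [hi]; exact hmain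
  · exact hother i hi

/-! ### Asymptotics -/

open Classical in
theorem card_windowKeys_le {b : ℕ → ℕ} (hpow : ∀ n : ℕ, 1 ≤ n → ∃ j : ℕ, b n = 2 ^ j)
    {R r₀ l k : ℕ} (hr : r₀ + l ≤ 2 ^ R) (hk : R ≤ level b k) :
    (windowKeys (flips b) r₀ l).card ≤ ∏ i ∈ Finset.Icc 1 k, b i := by
  rw [← two_pow_sum_log hpow, ← card_filter_notMem_flips, ← Finset.card_powerset]
  refine Finset.card_le_card fun a ha => Finset.mem_powerset.2 fun i hi => ?_
  have h1 := windowKeys_lt hr a ha i hi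
  obtain ⟨j, -, rfl⟩ := Finset.mem_image.1 ha
  exact Finset.mem_filter.2 ⟨Finset.mem_range.2 (by omega), (mem_key.1 hi).2⟩

/-- A long window contains many independent signs. -/
theorem le_card_windowKeys {b : ℕ → ℕ} {r₀ l k : ℕ} (hl : 2 * 2 ^ level b k ≤ l) :
    ∑ i ∈ Finset.Icc 1 k, Nat.log 2 (b i) ≤ (windowKeys (flips b) r₀ l).card := by
  classical
  rw [← card_filter_notMem_flips]
  obtain ⟨L, hL⟩ : ∃ L, L = level b k := ⟨_, rfl⟩
  rw [← hL] at hl ⊢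
  have hp : 0 < 2 ^ L := by positivity
  -- The window contains the whole block number `q` of `2 ^ L` letters.
  obtain ⟨q, hq1, hq2⟩ : ∃ q, r₀ ≤ q * 2 ^ L ∧ q * 2 ^ L + 2 ^ L ≤ r₀ + l := by
    refine ⟨r₀ / 2 ^ L + 1, ?_, ?_⟩
    · exact (Nat.lt_div_mul_add hp).le.trans (by rw [add_mul, one_mul])
    · have := Nat.div_mul_le_self r₀ (2 ^ L)
      rw [add_mul, one_mul]; omega
  have hlt : ∀ i < L, 2 ^ i < 2 ^ L := fun i hi => Nat.pow_lt_pow_right (by norm_num) hi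
  refine Finset.card_le_card_of_injOn (fun i => key (flips b) (q * 2 ^ L + 2 ^ i)) ?_ ?_
  · intro i hi
    have hi' := Finset.mem_range.1 (Finset.mem_filter.1 (Finset.mem_coe.1 hi)).1
    have := hlt i hi'
    have := Nat.two_pow_pos i
    refine Finset.mem_coe.2 (Finset.mem_image.2
      ⟨q * 2 ^ L + 2 ^ i - r₀, Finset.mem_range.2 (by omega), ?_⟩)
    rw [Nat.add_sub_cancel' (by omega)]
  · intro i hi j hj hij
    obtain ⟨hi1, hi2⟩ := Finset.mem_filter.1 (Finset.mem_coe.1 hi)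
    obtain ⟨hj1, hj2⟩ := Finset.mem_filter.1 (Finset.mem_coe.1 hj)
    rw [Finset.mem_range] at hi1 hj1
    have h1 : i ∈ key (flips b) (q * 2 ^ L + 2 ^ i) :=
      mem_key.2 ⟨(mem_bits_mul_pow_add (hlt i hi1)).2
        (Or.inl (mem_bits.2 Nat.testBit_two_pow_self)), hi2⟩
    simp only at hij
    rw [hij, mem_key, mem_bits_mul_pow_add (hlt j hj1), mem_bits_mul_pow, mem_bits,
      Nat.testBit_two_pow] at h1
    rcases h1.1 with h | h
    · simpa using (of_decide_eq_true h).symm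
    · omega

/-- For long windows, the probability `p` of a match is small, the blocks are long, and the distance
`D` of the blocks with the same signs is large compared with `1 / p`. The last claim is where the
growth of `b` enters: `1 / p` is at most the number of the words in the first family whose words
are longer than the blocks, and `D` is at least the next term of `b`. -/
theorem window_asymptotics {b : ℕ → ℕ} (hpow : ∀ n : ℕ, 1 ≤ n → ∃ j : ℕ, b n = 2 ^ j)
    (hgrowth : Tendsto (fun n : ℕ => (b (n + 1) : ℝ) / 2 ^ (∏ i ∈ Finset.Icc 1 n, b i))
      atTop atTop) (M : ℝ) :
    ∃ l₀, ∀ R r₀ l : ℕ, l₀ ≤ l → r₀ + l ≤ 2 ^ R → ∀ p : ℝ,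
      p = 2⁻¹ ^ (windowKeys (flips b) r₀ l).card →
      M * p ≤ 1 ∧ M ≤ 2 ^ (R + 1) - 1 ∧ ∃ D : ℕ, 0 < D ∧ M ≤ p * D ∧
        ∀ q q', q < q' → key (flips b) (q' * 2 ^ R) = key (flips b) (q * 2 ^ R) →
          par (flips b) (q' * 2 ^ R) = par (flips b) (q * 2 ^ R) → q / D ≠ q' / D := by
  obtain ⟨k₀, hk₀⟩ := eventually_atTop.1 (hgrowth.eventually_ge_atTop (max M 1))
  obtain ⟨T, hT⟩ := pow_unbounded_of_one_lt M (by norm_num : (1 : ℝ) < 2)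
  -- The sum of the logarithms grows since `b` does.
  obtain ⟨k₁, hk₁⟩ : ∃ k₁, T ≤ ∑ i ∈ Finset.Icc 1 k₁, Nat.log 2 (b i) := by
    obtain ⟨n, hn⟩ := (hgrowth.eventually_ge_atTop ((2 : ℝ) ^ T)).exists
    refine ⟨n + 1, ?_⟩
    have h1 : (2 : ℝ) ^ T ≤ b (n + 1) := hn.trans (div_le_self (by positivity)
      (one_le_pow₀ (by norm_num)))
    have h2 : 2 ^ T ≤ 2 ^ Nat.log 2 (b (n + 1)) := by
      rw [two_pow_log hpow (by omega)]
      exact_mod_cast h1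
    have h3 := (Nat.pow_le_pow_iff_right (by norm_num)).1 h2
    exact h3.trans (Finset.single_le_sum (f := fun i => Nat.log 2 (b i))
      (fun _ _ => Nat.zero_le _) (Finset.mem_Icc.2 ⟨by omega, le_rfl⟩))
  refine ⟨2 * 2 ^ level b k₁ + 2 ^ T + 2 ^ (flipPos b k₀ + 1), fun R r₀ l hl hr p hp => ?_⟩
  have hlR : l ≤ 2 ^ R := by omega
  have := Nat.two_pow_pos (level b k₁)
  have := Nat.two_pow_pos T
  have := Nat.two_pow_pos (flipPos b k₀ + 1)
  refine ⟨?_, ?_, ?_⟩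
  · have h1 : T ≤ (windowKeys (flips b) r₀ l).card :=
      hk₁.trans (le_card_windowKeys (by omega))
    have h2 : p ≤ 2⁻¹ ^ T := by
      rw [hp]; exact pow_le_pow_of_le_one (by norm_num) (by norm_num) h1
    have hp0 : 0 ≤ p := by rw [hp]; positivity
    calc M * p ≤ 2 ^ T * 2⁻¹ ^ T := by
          refine mul_le_mul hT.le h2 hp0 (by positivity)
      _ = 1 := by rw [← mul_pow]; norm_num
  · have h1 : (2 : ℝ) ^ T ≤ 2 ^ R := by exact_mod_cast (show 2 ^ T ≤ 2 ^ R by omega)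
    have h2 : (1 : ℝ) ≤ 2 ^ R := one_le_pow₀ (by norm_num)
    rw [pow_succ]; linarith
  · have hex : ∃ k, R ≤ flipPos b k := ⟨R, (flipPos_strictMono b).le_apply⟩
    -- The first flip position that is not inside the blocks of `2 ^ R` letters.
    obtain ⟨k, hk, hk'⟩ : ∃ k, R ≤ flipPos b k ∧ ∀ j < k, flipPos b j < R :=
      ⟨Nat.find hex, Nat.find_spec hex, fun j hj => not_le.1 (Nat.find_min hex hj)⟩
    have hkk : k₀ ≤ k := by
      by_contra h
      have h1 := flipPos_strictMono b (not_le.1 h)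
      have h2 : 2 ^ (flipPos b k₀ + 1) ≤ 2 ^ R := by omega
      have := (Nat.pow_le_pow_iff_right (by norm_num)).1 h2
      omega
    refine ⟨2 ^ (flipPos b (k + 1) - R), by positivity, ?_, fun q q' hqq h1 h2 =>
      div_ne_div_of_key_eq hk hk' hqq.ne h1 h2⟩
    have h1 := (le_max_left M 1).trans (hk₀ (k + 1) (by omega))
    have h2 : (windowKeys (flips b) r₀ l).card ≤ ∏ i ∈ Finset.Icc 1 (k + 1), b i :=
      card_windowKeys_le hpow hr (by rw [level_succ]; omega)
    have h3 : b (k + 1 + 1) ≤ 2 ^ (flipPos b (k + 1) - R) := by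
      rw [← two_pow_log hpow (i := k + 1 + 1) (by omega)]
      refine Nat.pow_le_pow_right (by norm_num) ?_
      have := level_succ b k
      rw [flipPos.eq_1 b (k + 1)]
      omega
    calc M ≤ _ := h1
      _ = 2⁻¹ ^ (∏ i ∈ Finset.Icc 1 (k + 1), b i) * (b (k + 1 + 1) : ℝ) := by
        rw [inv_pow, div_eq_inv_mul]
      _ ≤ p * ((2 ^ (flipPos b (k + 1) - R) : ℕ) : ℝ) := by
        refine mul_le_mul ?_ (by exact_mod_cast h3) (by positivity) (by rw [hp]; positivity)
        rw [hp]
        exact pow_le_pow_of_le_one (by norm_num) (by norm_num) h2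

/-! ### Hitting and return laws -/

/-- The probabilities of the returns to `B` after more than `k` steps, for `k < K`, sum up to the
probability of a visit to `B` at one of the times `1, …, K`. -/
theorem sum_real_noReturn {μ : Measure Point} [IsProbabilityMeasure μ]
    (hT : MeasurePreserving shift μ μ) {B : Set Point} (hB : MeasurableSet B) (K : ℕ) :
    ∑ k ∈ Finset.range K, μ.real (B ∩ noReturn B k) = 1 - μ.real (noReturn B K) := by
  induction K with
  | zero =>
    have : noReturn B 0 = Set.univ := Set.eq_univ_of_forall fun y k h1 h2 => by omega
    simp [this]
  | succ K ih =>
    have h1 : noReturn B (K + 1) = shift ⁻¹' (noReturn B K \ B) := by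
      ext y
      constructor
      · intro h
        refine ⟨fun k hk1 hk2 => ?_, ?_⟩
        · rw [← Function.iterate_succ_apply]; exact h (k + 1) (by omega) (by omega)
        · exact h 1 le_rfl (by omega)
      · rintro ⟨h, h'⟩ k hk1 hk2
        obtain ⟨k, rfl⟩ := Nat.exists_eq_succ_of_ne_zero (by omega : k ≠ 0)
        rw [Function.iterate_succ_apply]
        rcases Nat.eq_zero_or_pos k with rfl | hk
        · exact h'
        · exact h k hk (by omega)
    have h2 : μ.real (noReturn B (K + 1)) = μ.real (noReturn B K \ B) := by
      rw [h1, hT.measureReal_preimage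
        ((measurableSet_noReturn hB K).diff hB).nullMeasurableSet]
    have h3 := measureReal_inter_add_sdiff (μ := μ) (s := noReturn B K) hB
    rw [Finset.sum_range_succ, ih, h2, Set.inter_comm]
    linarith

theorem hitsBefore_eq {μ : Measure Point} [IsProbabilityMeasure μ] {B : Set Point}
    (hB : 0 < μ.real B) {t : ℝ} (ht : 0 ≤ t) :
    hitsBefore μ B t = (noReturn B ⌊t / μ.real B⌋₊)ᶜ := by
  have key : ∀ k : ℕ, μ B * (k : ENNReal) ≤ ENNReal.ofReal t ↔ k ≤ ⌊t / μ.real B⌋₊ := fun k => by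
    rw [Nat.le_floor_iff (by positivity), le_div_iff₀ hB, mul_comm,
      ← ENNReal.ofReal_toReal (measure_ne_top μ B), ← ENNReal.ofReal_natCast,
      ← ENNReal.ofReal_mul (by positivity), ENNReal.ofReal_le_ofReal_iff ht]
    rfl
  have hB' : μ B ≠ 0 := fun h => by simp [measureReal_def, h] at hB
  ext y
  simp only [hitsBefore, noReturn, Set.mem_ofPred_eq, Set.mem_compl_iff, not_forall, not_not]
  constructor
  · intro h
    by_cases hne : ∃ k, 1 ≤ k ∧ shift^[k] y ∈ B
    · have hτ : ((sInf {k | 1 ≤ k ∧ shift^[k] y ∈ B} : ℕ) : ℕ∞) ≤ hittingTime B y :=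
        le_iInf₂ fun k hk => Nat.cast_le.2 (Nat.sInf_le hk)
      have hmem := Nat.sInf_mem (s := {k | 1 ≤ k ∧ shift^[k] y ∈ B}) hne
      refine ⟨_, hmem.1, (key _).1 (le_trans ?_ h), hmem.2⟩
      gcongr
      exact_mod_cast hτ
    · have hτ : hittingTime B y = ⊤ := by
        rw [hittingTime, iInf₂_eq_top]
        exact fun k hk => absurd ⟨k, hk⟩ hne
      rw [hτ, ENat.toENNReal_top, ENNReal.mul_top hB'] at h
      exact absurd h (by simp)
  · rintro ⟨k, hk1, hk2, hk⟩
    refine le_trans ?_ ((key k).2 hk2)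
    have hτ : hittingTime B y ≤ k := iInf₂_le k ⟨hk1, hk⟩
    gcongr
    exact_mod_cast hτ

theorem hittingLaw_eq {μ : Measure Point} [IsProbabilityMeasure μ]
    (hT : MeasurePreserving shift μ μ) {B : Set Point} (hBm : MeasurableSet B) (hB : 0 < μ.real B)
    {t : ℝ} (ht : 0 ≤ t) :
    hittingLaw μ B t = ∑ k ∈ Finset.range ⌊t / μ.real B⌋₊, μ.real (B ∩ noReturn B k) := by
  rw [hittingLaw, hitsBefore_eq hB ht, probReal_compl_eq_one_sub (measurableSet_noReturn hBm _),
    sum_real_noReturn hT hBm]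

theorem returnLaw_eq {μ : Measure Point} [IsProbabilityMeasure μ] {B : Set Point}
    (hBm : MeasurableSet B) (hB : 0 < μ.real B) {t : ℝ} (ht : 0 ≤ t) :
    returnLaw μ B t = 1 - μ.real (B ∩ noReturn B ⌊t / μ.real B⌋₊) / μ.real B := by
  have h1 : B ∩ (B ∩ hitsBefore μ B t) = B \ noReturn B ⌊t / μ.real B⌋₊ := by
    rw [hitsBefore_eq hB ht, ← Set.inter_assoc, Set.inter_self, Set.sdiff_eq_compl_inter,
      Set.inter_comm]
  have h2 := measureReal_inter_add_sdiff (μ := μ) (s := B)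
    (measurableSet_noReturn hBm ⌊t / μ.real B⌋₊)
  rw [returnLaw, measureReal_def, ProbabilityTheory.cond_apply hBm, ENNReal.toReal_mul,
    ENNReal.toReal_inv, ← measureReal_def, ← measureReal_def, h1, eq_sub_iff_add_eq,
    ← div_eq_inv_mul, ← add_div, add_comm, h2, div_self hB.ne']

/-! ### From a lower bound to the exponential law -/

/-- If decreasing sequences `r n` with sums at most `1 / m n` are asymptotically at least
exponential on the scale `1 / m n`, then they are exponential, since the exponential density has the
integral `1`. -/
theorem tendsto_exp_of_le {r : ℕ → ℕ → ℝ} {m : ℕ → ℝ} (hm0 : ∀ n, 0 < m n)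
    (hm : Tendsto m atTop (𝓝 0)) (hanti : ∀ n, Antitone (r n)) (hr0 : ∀ n k, 0 ≤ r n k)
    (hr1 : ∀ n k, r n k ≤ 1) (hsum : ∀ n K, m n * ∑ k ∈ Finset.range K, r n k ≤ 1)
    (hlow : ∀ t > 0, ∀ ε > 0, ∀ᶠ n in atTop, Real.exp (-t) - ε ≤ r n ⌊t / m n⌋₊) {t : ℝ}
    (ht : 0 < t) :
    Tendsto (fun n => r n ⌊t / m n⌋₊) atTop (𝓝 (Real.exp (-t))) ∧
    Tendsto (fun n => m n * ∑ k ∈ Finset.range ⌊t / m n⌋₊, r n k) atTop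
      (𝓝 (1 - Real.exp (-t))) := by
  let g : ℕ → ℝ → ℝ := fun n s => r n ⌊s / m n⌋₊
  have hg : ∀ n, Antitone (g n) := fun n s s' h => hanti n
    (Nat.floor_le_floor (div_le_div_of_nonneg_right h (hm0 n).le))
  have hgi : ∀ n a b, IntervalIntegrable (g n) volume a b := fun n a b =>
    (hg n).intervalIntegrable
  have hg0 : ∀ n s, 0 ≤ g n s := fun n s => hr0 n _
  let f : ℕ → ℝ → ℝ := fun n u => r n ⌊u⌋₊
  have hf : ∀ n, Antitone (f n) := fun n s s' h => hanti n (Nat.floor_le_floor h)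
  have hscale : ∀ n (K : ℕ), ∫ s in (0 : ℝ)..(K * m n), g n s = m n * ∫ u in (0 : ℝ)..K, f n u :=
    fun n K => by
      have := intervalIntegral.integral_comp_div (a := 0) (b := K * m n) (f n) (hm0 n).ne'
      rw [zero_div, mul_div_cancel_right₀ _ (hm0 n).ne', smul_eq_mul] at this
      exact this
  have hup : ∀ n (K : ℕ), ∫ s in (0 : ℝ)..(K * m n), g n s ≤
      m n * ∑ k ∈ Finset.range K, r n k := fun n K => by
    rw [hscale]
    refine mul_le_mul_of_nonneg_left ?_ (hm0 n).le
    have := AntitoneOn.integral_le_sum (x₀ := 0) (a := K) ((hf n).antitoneOn _)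
    simpa [f] using this
  have hdown : ∀ n (K : ℕ), m n * ∑ k ∈ Finset.range K, r n k - m n ≤
      ∫ s in (0 : ℝ)..(K * m n), g n s := fun n K => by
    rw [hscale, ← mul_sub_one]
    refine mul_le_mul_of_nonneg_left ?_ (hm0 n).le
    have h1 := AntitoneOn.sum_le_integral (x₀ := 0) (a := K) ((hf n).antitoneOn _)
    have h2 : ∑ k ∈ Finset.range K, r n (k + 1) ≤ ∫ u in (0 : ℝ)..K, f n u := by
      have hcast : ∀ i : ℕ, ⌊((i : ℝ) + 1)⌋₊ = i + 1 := fun i => by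
        exact_mod_cast Nat.floor_natCast (R := ℝ) (i + 1)
      simpa [f, hcast] using h1
    have h3 := Finset.sum_range_succ' (r n) K
    have h4 := Finset.sum_range_succ (r n) K
    have := hr0 n K
    have := hr1 n 0
    linarith
  have hmono : ∀ n {a b : ℝ}, a ≤ b → ∫ s in (0 : ℝ)..a, g n s ≤ ∫ s in (0 : ℝ)..b, g n s :=
    fun n a b hab => by
      rw [← sub_nonneg, intervalIntegral.integral_interval_sub_left (hgi n _ _) (hgi n _ _)]
      exact intervalIntegral.integral_nonneg hab fun s _ => hg0 n s
  have hle1 : ∀ n T, ∫ s in (0 : ℝ)..T, g n s ≤ 1 := fun n T =>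
    (hmono n ((div_le_iff₀ (hm0 n)).1 (Nat.le_ceil _))).trans ((hup n _).trans (hsum n _))
  -- The part of `g n` below the exponential function converges to it.
  let h : ℕ → ℝ → ℝ := fun n s => min (g n s) (Real.exp (-s))
  have hhi : ∀ n a b, IntervalIntegrable (h n) volume a b := fun n a b =>
    (hg n).inf (fun x y hxy => Real.exp_le_exp.2 (neg_le_neg hxy)) |>.intervalIntegrable
  have hexp : ∀ a b : ℝ, ∫ s in a..b, Real.exp (-s) = Real.exp (-a) - Real.exp (-b) := fun a b => by
    rw [intervalIntegral.integral_comp_neg fun s => Real.exp s, integral_exp]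
  have hlim : ∀ a b, 0 ≤ a → a ≤ b → Tendsto (fun n => ∫ s in a..b, h n s) atTop
      (𝓝 (Real.exp (-a) - Real.exp (-b))) := by
    intro a b ha hab
    rw [← hexp]
    refine intervalIntegral.tendsto_integral_filter_of_dominated_convergence (fun _ => 1)
      (Eventually.of_forall fun n => ?_) (Eventually.of_forall fun n => ?_) (by simp)
      (Eventually.of_forall fun s hs => ?_)
    · exact (hhi n a b).def'.aestronglyMeasurable
    · refine Eventually.of_forall fun s _ => ?_
      rw [Real.norm_eq_abs, abs_of_nonneg (le_min (hg0 n s) (Real.exp_pos _).le)]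
      exact (min_le_left _ _).trans (hr1 n _)
    · rw [Set.uIoc_of_le hab] at hs
      have hs0 : 0 < s := ha.trans_lt hs.1
      refine tendsto_order.2 ⟨fun c hc => ?_, fun c hc => Eventually.of_forall fun n =>
        (min_le_right _ _).trans_lt hc⟩
      filter_upwards [hlow s hs0 ((Real.exp (-s) - c) / 2) (by linarith)] with n hn
      exact lt_min (by change c < r n _; linarith) hc
  have hhle : ∀ n {a b}, a ≤ b → ∫ s in a..b, h n s ≤ ∫ s in a..b, g n s := fun n a b hab =>
    intervalIntegral.integral_mono_on hab (hhi n a b) (hgi n a b) fun s _ => min_le_left _ _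
  have hI : ∀ T, 0 ≤ T → Tendsto (fun n => ∫ s in (0 : ℝ)..T, g n s) atTop
      (𝓝 (1 - Real.exp (-T))) := by
    intro T hT
    refine tendsto_order.2 ⟨fun c hc => ?_, fun c hc => ?_⟩
    · have := hlim 0 T le_rfl hT
      rw [neg_zero, Real.exp_zero] at this
      filter_upwards [(tendsto_order.1 this).1 c hc] with n hn
      exact hn.trans_le (hhle n hT)
    · have hex : ∀ᶠ S in atTop, Real.exp (-S) < (c - (1 - Real.exp (-T))) / 2 :=
        (tendsto_order.1 Real.tendsto_exp_neg_atTop_nhds_zero).2 _ (by linarith)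
      obtain ⟨S, hS, hTS⟩ := (hex.and (eventually_ge_atTop T)).exists
      filter_upwards [(tendsto_order.1 (hlim T S hT hTS)).1
        (Real.exp (-T) - Real.exp (-S) - (c - (1 - Real.exp (-T))) / 2) (by linarith)] with n hn
      have h1 := hle1 n S
      have h2 := intervalIntegral.integral_add_adjacent_intervals (hgi n 0 T) (hgi n T S)
      have h3 := hhle n hTS
      linarith
  refine ⟨tendsto_order.2 ⟨fun c hc => ?_, fun c hc => ?_⟩, ?_⟩
  · filter_upwards [hlow t ht ((Real.exp (-t) - c) / 2) (by linarith)] with n hn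
    linarith
  · -- The mean of `g n` over a short interval before `t` is an upper bound for `g n t`.
    have hcont : Tendsto (fun δ => Real.exp (-(t - δ))) (𝓝[>] 0) (𝓝 (Real.exp (-t))) := by
      have : Continuous fun δ => Real.exp (-(t - δ)) := by fun_prop
      have := (this.tendsto 0).mono_left (nhdsWithin_le_nhds (s := Set.Ioi 0))
      simpa using this
    obtain ⟨δ, hδc, hδ0, hδt⟩ := (((tendsto_order.1 hcont).2 c hc).and
      ((eventually_mem_nhdsWithin (a := (0 : ℝ)) (s := Set.Ioi 0)).and
        (nhdsWithin_le_nhds (Iio_mem_nhds ht)))).exists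
    rw [Set.mem_Ioi] at hδ0
    have hslope : Real.exp (-(t - δ)) - Real.exp (-t) < δ * c := by
      have h1 : Real.exp (-t) = Real.exp (-(t - δ)) * Real.exp (-δ) := by
        rw [← Real.exp_add]; congr 1; ring
      have h2 := Real.add_one_le_exp (-δ)
      have h3 := Real.exp_pos (-(t - δ))
      rw [h1]
      nlinarith
    have hdiff := (hI t ht.le).sub (hI (t - δ) (by linarith))
    filter_upwards [(tendsto_order.1 hdiff).2 (δ * c) (by linarith)] with n hn
    rw [intervalIntegral.integral_interval_sub_left (hgi n _ _) (hgi n _ _)] at hn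
    have h1 : ∫ _ in (t - δ)..t, g n t ≤ ∫ s in (t - δ)..t, g n s :=
      intervalIntegral.integral_mono_on (by linarith) (by simp) (hgi n _ _) fun s hs => hg n hs.2
    rw [intervalIntegral.integral_const, smul_eq_mul, sub_sub_cancel] at h1
    exact lt_of_mul_lt_mul_left (h1.trans_lt hn) hδ0.le
  · have hIt := hI t ht.le
    refine tendsto_of_tendsto_of_tendsto_of_le_of_le (by simpa using hIt.sub hm)
      (by simpa using hIt.add hm) (fun n => ?_) fun n => ?_
    · have h1 := hup n (⌊t / m n⌋₊ + 1)
      rw [Finset.sum_range_succ, mul_add] at h1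
      have h2 := hmono n ((div_le_iff₀ (hm0 n)).1 (Nat.lt_floor_add_one (t / m n)).le)
      push_cast at h1
      have h3 : m n * r n ⌊t / m n⌋₊ ≤ m n * 1 :=
        mul_le_mul_of_nonneg_left (hr1 n _) (hm0 n).le
      linarith
    · have h1 := hdown n ⌊t / m n⌋₊
      have h2 := hmono n ((le_div_iff₀ (hm0 n)).1 (Nat.floor_le (div_pos ht (hm0 n)).le))
      linarith

/-! ### The exponential law -/

theorem dependsOn_cylinder (x : Point) (n : ℕ) :
    DependsOn (· ∈ PiNat.cylinder x n) (Set.Iio n) := fun y z h =>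
  propext (forall₂_congr fun i hi => by rw [h i hi])

theorem exists_freq_pos {C : Set ℕ} {μ : ProbabilityMeasure Point}
    (hμ : Tendsto (cesaro (pointLaw C)) atTop (𝓝 μ)) {V : Set Point} {n : ℕ}
    (hV : DependsOn (· ∈ V) (Set.Iio n)) (hpos : 0 < (μ : Measure Point).real V) :
    ∃ i, 0 < freq C V i := by
  obtain ⟨N, hN⟩ := ((tendsto_order.1 (tendsto_real_of_dependsOn hμ hV)).1 0 hpos).exists
  by_contra! h
  rw [cesaro_real (measurableSet_of_dependsOn hV)] at hN
  refine absurd hN (not_lt.2 (div_nonpos_of_nonpos_of_nonneg ?_ (by positivity)))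
  exact Finset.sum_nonpos fun i _ => h i

theorem real_cylinder_pos {μ : ProbabilityMeasure Point} {x : Point}
    (hx : x ∈ (μ : Measure Point).support) (n : ℕ) :
    0 < (μ : Measure Point).real (PiNat.cylinder x n) := by
  have h := (Measure.mem_support_iff_forall x).1 hx (PiNat.cylinder x n)
    ((PiNat.isOpen_cylinder _ x n).mem_nhds (PiNat.self_mem_cylinder x n))
  exact ENNReal.toReal_pos h.ne' (measure_ne_top _ _)

theorem infinite_ne_zero {x : Point} (hx : x ∉ ⋃ i : ℕ, shift^[i] ⁻¹' {fun _ => 0}) :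
    {j | x j ≠ 0}.Infinite := by
  intro hfin
  obtain ⟨N, hN⟩ := hfin.bddAbove
  refine hx (Set.mem_iUnion.2 ⟨N + 1, funext fun j => ?_⟩)
  rw [shift_iterate_apply]
  by_contra h
  have : N + 1 + j ≤ N := hN h
  omega

/-- The long cylinders at a good point are seen through long windows. -/
theorem exists_isWindow_cylinder {C : Set ℕ} {μ : ProbabilityMeasure Point}
    (hμ : Tendsto (cesaro (pointLaw C)) atTop (𝓝 μ)) {x : Point}
    (hx : x ∈ goodPoints (μ : Measure Point)) (l₀ : ℕ) :
    ∀ᶠ n in atTop, ∃ σ R r₀ l s, IsWindow C (PiNat.cylinder x n) σ R r₀ l s ∧ l₀ ≤ l := by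
  obtain ⟨F, hF, hcard⟩ := (infinite_ne_zero hx.2).exists_subset_card_eq (l₀ + 1)
  filter_upwards [eventually_ge_atTop (F.sup id + 1)] with n hn
  have hFn : ∀ j ∈ F, j < n := fun j hj => by
    have : j ≤ F.sup id := Finset.le_sup (f := id) hj
    omega
  obtain ⟨i₀, hi₀⟩ := exists_freq_pos hμ (dependsOn_cylinder x n) (real_cylinder_pos hx.1 n)
  obtain ⟨η₀, hη₀⟩ : ∃ η₀, shift^[i₀] (point C η₀) ∈ PiNat.cylinder x n := by
    by_contra! h
    have : {η | shift^[i₀] (point C η) ∈ PiNat.cylinder x n} = ∅ :=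
      Set.eq_empty_of_forall_notMem h
    rw [freq, this, measureReal_empty] at hi₀
    exact lt_irrefl _ hi₀
  have hxη : ∀ j < n, x j = point C η₀ (i₀ + j) := fun j hj =>
    (hη₀ j hj).symm.trans (shift_iterate_apply i₀ _ j)
  have hsub : F ⊆ (Finset.range n).filter fun j => point C η₀ (i₀ + j) ≠ 0 := fun j hj => by
    rw [Finset.mem_filter, Finset.mem_range, ← hxη j (hFn j hj)]
    exact ⟨hFn j hj, hF hj⟩
  have hle := Finset.card_le_card hsub
  obtain ⟨j, hj⟩ := Finset.card_pos.1 (by omega : 0 < F.card)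
  have hj' := Finset.mem_filter.1 (hsub hj)
  obtain ⟨R, r₀, q₀, l, s, h1, h2, h3, h4, h5⟩ :=
    exists_window C η₀ (i₀ := i₀) (n := n) ⟨j, Finset.mem_range.1 hj'.1, hj'.2⟩
  refine ⟨_, R, r₀, l, s, ⟨h1, h2, h3, fun η i => ?_, η₀, q₀, rfl⟩, by omega⟩
  rw [← Set.mem_ofPred_eq (p := fun η => shift^[i] (point C η) ∈ PiNat.cylinder x n)]
  refine Iff.trans ?_ (h5 η i)
  refine forall₂_congr fun k hk => ?_
  rw [shift_iterate_apply, hxη k hk]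

/-- The lower bound for the return probabilities, with all the errors expressed in terms of a single
large number `M`. Here `u` stands for the measure of the cylinder, `A + 1` for the mean length
`2 ^ (R + 1)` of the blocks, and `v` for the probability of a visit with no return in `K` steps. -/
theorem le_of_window_bounds {p A D t M u v : ℝ} {K m : ℕ} (ht : 0 < t) (hM : 2 < M)
    (hMt : 2 * t < M) (hp : 0 < p) (hMp : M * p ≤ 1) (hMA : M ≤ A) (hD : 0 < D) (hMD : M ≤ p * D)
    (hu1 : p / (A + 1) ≤ u) (hu2 : u ≤ p / A) (hK : (K : ℝ) ≤ t / u) (hm : (m : ℝ) ≤ K / A)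
    (hv : p / (A + 1) * ((1 - m / D) * √(1 - 2 * p) ^ m) ≤ v) :
    (1 - 1 / M) * (1 - 2 * t / M) * Real.exp (-(t * (1 + 1 / M) / (1 - 2 / M))) ≤ v / u := by
  have hM0 : 0 < M := by linarith
  have hA0 : 0 < A := by linarith
  have hu0 : 0 < u := lt_of_lt_of_le (by positivity) hu1
  have hMi : 1 / M < 1 / 2 := one_div_lt_one_div_of_lt (by norm_num) hM
  have hMi0 : 0 < 1 / M := by positivity
  have hpM : p ≤ 1 / M := by rw [le_div_iff₀ hM0]; linarith
  have hAM : 1 / A ≤ 1 / M := one_div_le_one_div_of_le hM0 hMA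
  -- The number `m` of the candidates is about `t / p`.
  have hmp : m * p ≤ t * (1 + 1 / M) := by
    have h1 : t / u ≤ t / (p / (A + 1)) := div_le_div_of_nonneg_left ht.le (by positivity) hu1
    have h2 : (m : ℝ) ≤ t / (p / (A + 1)) / A :=
      hm.trans (div_le_div_of_nonneg_right (hK.trans h1) hA0.le)
    calc m * p ≤ t / (p / (A + 1)) / A * p := mul_le_mul_of_nonneg_right h2 hp.le
      _ = t * (1 + 1 / A) := by field_simp
      _ ≤ _ := by gcongr
  have hmD : (m : ℝ) / D ≤ 2 * t / M := by
    rw [div_le_div_iff₀ hD hM0]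
    calc (m : ℝ) * M ≤ m * (p * D) := by gcongr
      _ = m * p * D := by ring
      _ ≤ 2 * t * D := by
        refine mul_le_mul_of_nonneg_right (hmp.trans ?_) hD.le
        nlinarith
  have hy0 : 0 < 1 - 2 * p := by linarith
  have hsqrt : Real.exp (-(p / (1 - 2 * p))) ≤ √(1 - 2 * p) := by
    refine Real.le_sqrt_of_sq_le ?_
    rw [← Real.exp_nat_mul]
    have h1 := Real.one_sub_inv_le_log_of_pos hy0
    refine le_trans (Real.exp_le_exp.2 (le_trans (le_of_eq ?_) h1)) (Real.exp_log hy0).le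
    push_cast
    field_simp
    ring
  have hpow : Real.exp (-(t * (1 + 1 / M) / (1 - 2 / M))) ≤ √(1 - 2 * p) ^ m := by
    refine le_trans ?_ (pow_le_pow_left₀ (Real.exp_pos _).le hsqrt m)
    rw [← Real.exp_nat_mul]
    refine Real.exp_le_exp.2 ?_
    rw [mul_neg, neg_le_neg_iff, ← mul_div_assoc]
    have h2 : 1 - 2 / M ≤ 1 - 2 * p := by
      have : 2 / M = 2 * (1 / M) := by ring
      linarith
    have h3 : 0 < 1 - 2 / M := by
      have : 2 / M = 2 * (1 / M) := by ring
      linarith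
    exact div_le_div₀ (by positivity) hmp h3 h2
  have hAf : 1 - 1 / M ≤ A / (A + 1) := by
    rw [le_div_iff₀ (by linarith)]
    have h1 : A * (1 / M) ≥ 1 := by
      rw [ge_iff_le, mul_one_div, one_le_div hM0]; exact hMA
    linarith
  have ht1 : 0 ≤ 1 - 2 * t / M := by
    rw [sub_nonneg, div_le_one hM0]; exact hMt.le
  have hv0 : 0 ≤ v := le_trans (by
    have : 0 ≤ 1 - m / D := by linarith
    positivity) hv
  calc (1 - 1 / M) * (1 - 2 * t / M) * Real.exp (-(t * (1 + 1 / M) / (1 - 2 / M)))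
      ≤ A / (A + 1) * (1 - m / D) * √(1 - 2 * p) ^ m := by
        refine mul_le_mul (mul_le_mul hAf (by linarith) ht1 (by positivity)) hpow
          (Real.exp_pos _).le (mul_nonneg (by positivity) (by linarith))
    _ = p / (A + 1) * ((1 - m / D) * √(1 - 2 * p) ^ m) / (p / A) := by field_simp
    _ ≤ v / (p / A) := div_le_div_of_nonneg_right hv (by positivity)
    _ ≤ v / u := div_le_div_of_nonneg_left hv0 hu0 hu2

theorem tendsto_window_bound (t : ℝ) :
    Tendsto (fun M : ℝ => (1 - 1 / M) * (1 - 2 * t / M) *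
      Real.exp (-(t * (1 + 1 / M) / (1 - 2 / M)))) atTop (𝓝 (Real.exp (-t))) := by
  have h : ∀ c : ℝ, Tendsto (fun M : ℝ => c / M) atTop (𝓝 0) := fun c =>
    tendsto_const_nhds.div_atTop tendsto_id
  have h1 := (((h 1).const_sub 1).mul ((h (2 * t)).const_sub 1)).mul
    ((Real.continuous_exp.tendsto _).comp
      ((((h 1).const_add 1).const_mul t).div ((h 2).const_sub 1) (by norm_num)).neg)
  simpa using h1

/-- The assumptions of `le_of_window_bounds` hold for the return to a cylinder. -/
theorem IsWindow.bounds {C : Set ℕ} {B : Set Point} {σ : ℕ → Bool} {R r₀ l s n : ℕ}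
    {μ : ProbabilityMeasure Point} (h : IsWindow C B σ R r₀ l s)
    (hB : DependsOn (· ∈ B) (Set.Iio n)) (hμ : Tendsto (cesaro (pointLaw C)) atTop (𝓝 μ))
    {p t M : ℝ} (hp : p = 2⁻¹ ^ (windowKeys C r₀ l).card) (ht : 0 < t) (hM : 2 < M)
    (hMt : 2 * t < M) (hMp : M * p ≤ 1) (hMA : M ≤ 2 ^ (R + 1) - 1) {D : ℕ} (hD0 : 0 < D)
    (hMD : M ≤ p * D)
    (hD : ∀ q q', q < q' → key C (q' * 2 ^ R) = key C (q * 2 ^ R) →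
      par C (q' * 2 ^ R) = par C (q * 2 ^ R) → q / D ≠ q' / D) :
    (μ : Measure Point).real B ≤ 1 / M ∧
    (1 - 1 / M) * (1 - 2 * t / M) * Real.exp (-(t * (1 + 1 / M) / (1 - 2 / M))) ≤
      (μ : Measure Point).real (B ∩ noReturn B ⌊t / (μ : Measure Point).real B⌋₊) /
        (μ : Measure Point).real B := by
  have hp0 : 0 < p := by rw [hp]; positivity
  have h1 := h.real_le hB hp hμ
  have h2 := h.le_real hB hp hμ hD0 hD 0 (Nat.zero_div _).symm
  have h0 : noReturn B 0 = Set.univ := Set.eq_univ_of_forall fun y k _ _ => by omega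
  rw [h0, Set.inter_univ, Nat.cast_zero, zero_div, sub_zero, pow_zero, mul_one, mul_one] at h2
  have h3 := h.le_real hB hp hμ hD0 hD ⌊t / (μ : Measure Point).real B⌋₊ rfl
  have hA : (2 : ℝ) ^ (R + 1) = (2 ^ (R + 1) - 1) + 1 := by ring
  have hu : 0 ≤ (μ : Measure Point).real B := measureReal_nonneg
  refine ⟨?_, le_of_window_bounds (A := 2 ^ (R + 1) - 1) ht hM hMt hp0 hMp hMA
    (by exact_mod_cast hD0) hMD (by rwa [← hA]) h1 (Nat.floor_le (div_nonneg ht.le hu)) ?_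
    (by rwa [← hA])⟩
  · refine h1.trans ((div_le_self hp0.le (by linarith)).trans ?_)
    rw [le_div_iff₀ (by linarith)]; linarith
  · refine Nat.cast_div_le.trans (le_of_eq ?_)
    rw [Nat.cast_sub Nat.one_le_two_pow]
    simp

theorem tendsto_laws {b : ℕ → ℕ} (hpow : ∀ n : ℕ, 1 ≤ n → ∃ j : ℕ, b n = 2 ^ j)
    (hgrowth : Tendsto (fun n : ℕ => (b (n + 1) : ℝ) / 2 ^ (∏ i ∈ Finset.Icc 1 n, b i))
      atTop atTop) {μ : ProbabilityMeasure Point}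
    (hμ : Tendsto (cesaro (pointLaw (flips b))) atTop (𝓝 μ)) {x : Point}
    (hx : x ∈ goodPoints (μ : Measure Point)) {t : ℝ} (ht : 0 < t) :
    Tendsto (fun n : ℕ => returnLaw μ (PiNat.cylinder x n) t) atTop (𝓝 (1 - Real.exp (-t))) ∧
    Tendsto (fun n : ℕ => hittingLaw μ (PiNat.cylinder x n) t) atTop
      (𝓝 (1 - Real.exp (-t))) := by
  have hT := measurePreserving_shift_of_tendsto hμ
  have hBm : ∀ n, MeasurableSet (PiNat.cylinder x n) := fun n =>
    measurableSet_of_dependsOn (dependsOn_cylinder x n)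
  let m : ℕ → ℝ := fun n => (μ : Measure Point).real (PiNat.cylinder x n)
  have hm0 : ∀ n, 0 < m n := real_cylinder_pos hx.1
  let r : ℕ → ℕ → ℝ := fun n k =>
    (μ : Measure Point).real (PiNat.cylinder x n ∩ noReturn (PiNat.cylinder x n) k) / m n
  have hbounds : ∀ s > 0, ∀ᶠ M in atTop, ∀ᶠ n in atTop, m n ≤ 1 / M ∧
      (1 - 1 / M) * (1 - 2 * s / M) * Real.exp (-(s * (1 + 1 / M) / (1 - 2 / M))) ≤
        r n ⌊s / m n⌋₊ := by
    intro s hs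
    filter_upwards [eventually_gt_atTop (2 : ℝ), eventually_gt_atTop (2 * s)] with M hM hMs
    obtain ⟨l₀, hl₀⟩ := window_asymptotics hpow hgrowth M
    filter_upwards [exists_isWindow_cylinder hμ hx l₀] with n hn
    obtain ⟨σ, R, r₀, l, s', hw, hl⟩ := hn
    obtain ⟨h1, h2, D, h3, h4, h5⟩ := hl₀ R r₀ l hl hw.window_le _ rfl
    exact hw.bounds (dependsOn_cylinder x n) hμ rfl hs hM hMs h1 h2 h3 h4 h5
  have hm : Tendsto m atTop (𝓝 0) := by
    refine tendsto_order.2 ⟨fun c hc => Eventually.of_forall fun n => hc.trans (hm0 n),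
      fun c hc => ?_⟩
    have h1 : ∀ᶠ M : ℝ in atTop, 1 / M < c :=
      (tendsto_order.1 (tendsto_const_nhds.div_atTop tendsto_id)).2 c hc
    obtain ⟨M, hM, hM'⟩ := ((hbounds 1 one_pos).and h1).exists
    filter_upwards [hM] with n hn
    exact hn.1.trans_lt hM'
  have hlow : ∀ s > 0, ∀ ε > 0, ∀ᶠ n in atTop, Real.exp (-s) - ε ≤ r n ⌊s / m n⌋₊ := by
    intro s hs ε hε
    obtain ⟨M, hM, hM'⟩ := ((hbounds s hs).and
      ((tendsto_order.1 (tendsto_window_bound s)).1 (Real.exp (-s) - ε) (by linarith))).exists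
    filter_upwards [hM] with n hn
    exact hM'.le.trans hn.2
  have hsumr : ∀ n K, m n * ∑ k ∈ Finset.range K, r n k =
      ∑ k ∈ Finset.range K, (μ : Measure Point).real
        (PiNat.cylinder x n ∩ noReturn (PiNat.cylinder x n) k) := fun n K => by
    rw [← Finset.sum_div, mul_div_cancel₀ _ (hm0 n).ne']
  have hanti : ∀ n, Antitone (r n) := fun n k k' hk => by
    refine div_le_div_of_nonneg_right (measureReal_mono ?_) (hm0 n).le
    exact Set.inter_subset_inter_right _ fun y hy j h1 h2 => hy j h1 (h2.trans hk)
  have hr0 : ∀ n k, 0 ≤ r n k := fun n k => div_nonneg measureReal_nonneg (hm0 n).le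
  have hr1 : ∀ n k, r n k ≤ 1 := fun n k =>
    div_le_one_of_le₀ (measureReal_mono Set.inter_subset_left) (hm0 n).le
  have hsum : ∀ n K, m n * ∑ k ∈ Finset.range K, r n k ≤ 1 := fun n K => by
    rw [hsumr, sum_real_noReturn hT (hBm n)]
    exact sub_le_self _ measureReal_nonneg
  have hmain := tendsto_exp_of_le hm0 hm hanti hr0 hr1 hsum hlow ht
  refine ⟨(hmain.1.const_sub 1).congr fun n => ?_, hmain.2.congr fun n => ?_⟩
  · exact (returnLaw_eq (hBm n) (hm0 n) ht.le).symm
  · rw [hsumr, hittingLaw_eq hT (hBm n) (hm0 n) ht.le]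

/-! ### Words and cylinders -/

theorem mem_wordCylinder_iff {u : List (Fin 3)} {y : Point} :
    y ∈ wordCylinder u ↔ (List.range u.length).map y = u := by
  constructor
  · intro h
    refine List.ext_getElem (by simp) fun i h1 h2 => ?_
    simpa using h i h2
  · intro h i hi
    have := List.getElem_of_eq h (i := i) (by simpa using hi)
    simpa using this

theorem dependsOn_wordCylinder (u : List (Fin 3)) :
    DependsOn (· ∈ wordCylinder u) (Set.Iio u.length) := fun x y h =>
  propext (forall₂_congr fun i hi => by rw [h i hi])

theorem measure_eq_sum_wordCylinder (ν : Measure Point) {V : Set Point} (hV : MeasurableSet V)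
    (n : ℕ) :
    ν V = ∑ u ∈ (List.finite_length_eq (Fin 3) n).toFinset, ν (V ∩ wordCylinder u) := by
  rw [← measure_biUnion_finset]
  · congr 1
    ext y
    simp only [Set.mem_iUnion, Set.Finite.mem_toFinset, Set.mem_ofPred_eq]
    constructor
    · intro hy
      refine ⟨(List.range n).map y, by simp, hy, mem_wordCylinder_iff.2 (by simp)⟩
    · rintro ⟨u, -, hy, -⟩
      exact hy
  · intro u hu v hv huv
    rw [Function.onFun, Set.disjoint_left]
    rintro y ⟨-, hyu⟩ ⟨-, hyv⟩
    rw [mem_wordCylinder_iff] at hyu hyv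
    have hu' : u.length = n := by simpa using hu
    have hv' : v.length = n := by simpa using hv
    rw [hu'] at hyu
    rw [hv'] at hyv
    exact huv (hyu.symm.trans hyv)
  · exact fun u _ => hV.inter (measurableSet_of_dependsOn (dependsOn_wordCylinder u))

/-! ### The words of the families as initial words -/

/-- The initial word of `point C η` with `2 ^ L` nonzero letters and the zeros after the last one
of them. -/
def initWord (C : Set ℕ) (L : ℕ) (η : Finset ℕ → Bool) : List (Fin 3) :=
  (List.range (letterPos (2 ^ L))).map (point C η)

theorem withGaps_concat (vs : List (List (Fin 3))) (v : List (Fin 3)) :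
    withGaps (vs ++ [v]) = withGaps vs ++ (v ++ List.replicate (omega (vs.length + 1)) 0) := by
  simp [withGaps, List.mapIdx_concat]

theorem withGaps_map_initWord (C : Set ℕ) (L : ℕ) (η : Finset ℕ → Bool) (J : ℕ) :
    withGaps ((List.range J).map fun j => initWord C L (move C (j * 2 ^ L) η)) =
      (List.range (letterPos (J * 2 ^ L))).map (point C η) := by
  induction J with
  | zero => simp [withGaps, letterPos]
  | succ J ih =>
    have h1 := letterPos_succ_mul_pow J L
    have h2 := letterPos_two_pow L
    have h3 : letterPos ((J + 1) * 2 ^ L) =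
        letterPos (J * 2 ^ L) + (letterPos (2 ^ L) + omega (J + 1)) := by omega
    rw [List.range_succ, List.map_append, List.map_singleton, withGaps_concat, ih, h3,
      List.range_add, List.map_append]
    congr 1
    rw [List.range_add, List.map_append, List.map_append]
    congr 1
    · rw [List.map_map, initWord]
      refine List.map_congr_left fun i hi => ?_
      rw [Function.comp_apply, point_block C η J L (by have := List.mem_range.1 hi; omega)]
    · rw [List.length_map, List.length_range, List.map_map, List.map_map, eq_comm,
        List.eq_replicate_iff]
      refine ⟨by simp, fun a ha => ?_⟩
      obtain ⟨i, hi, rfl⟩ := List.mem_map.1 ha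
      have hi' := List.mem_range.1 hi
      refine point_eq_zero fun n hn => ?_
      simp only at hn
      have h4 : n < (J + 1) * 2 ^ L := letterPos_strictMono.lt_iff_lt.1 (by omega)
      have hp : 0 < 2 ^ L := by positivity
      have h5 : letterPos n ≤ letterPos (J * 2 ^ L + (2 ^ L - 1)) :=
        letterPos_strictMono.monotone (by rw [add_mul] at h4; omega)
      rw [letterPos_mul_pow_add J L (by omega)] at h5
      have h6 : letterPos (2 ^ L - 1) < letterPos (2 ^ L) := letterPos_strictMono (by omega)
      omega

theorem negWord_initWord (C : Set ℕ) (L : ℕ) (η : Finset ℕ → Bool) :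
    negWord (initWord C L η) = initWord C L fun a => !η a := by
  rw [negWord, initWord, initWord, List.map_map]
  refine List.map_congr_left fun j _ => ?_
  rw [Function.comp_apply]
  by_cases h : ∃ n, letterPos n = j
  · obtain ⟨n, rfl⟩ := h
    rw [point_letterPos, point_letterPos, sign, sign]
    cases η (key C n) <;> cases par C n <;> decide
  · rw [not_exists] at h
    rw [point_eq_zero h, point_eq_zero h]
    decide

theorem initWord_congr {C : Set ℕ} {L : ℕ} {η η' : Finset ℕ → Bool}
    (h : ∀ a : Finset ℕ, (∀ i ∈ a, i < L) → η a = η' a) : initWord C L η = initWord C L η' := by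
  refine List.map_congr_left fun j hj => ?_
  by_cases hn : ∃ n, letterPos n = j
  · obtain ⟨n, rfl⟩ := hn
    have hlt : n < 2 ^ L := letterPos_strictMono.lt_iff_lt.1 (List.mem_range.1 hj)
    rw [point_letterPos_eq_iff, sign, sign, h _ fun i hi => lt_of_mem_key hlt hi]
  · rw [not_exists] at hn
    rw [point_eq_zero hn, point_eq_zero hn]

theorem bits_two_pow (c : ℕ) : bits (2 ^ c) = {c} := by
  ext i
  rw [mem_bits, Nat.testBit_two_pow, Finset.mem_singleton, decide_eq_true_iff, eq_comm]

/-- In a word of the family number `k + 1`, the blocks of the second half are the reversed blocks of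
the first half. -/
theorem move_add (b : ℕ → ℕ) (k : ℕ) (η : Finset ℕ → Bool) {j : ℕ}
    (hj : j < 2 ^ Nat.log 2 (b (k + 1))) :
    move (flips b) ((2 ^ Nat.log 2 (b (k + 1)) + j) * 2 ^ level b k) η =
      fun a => !move (flips b) (j * 2 ^ level b k) η a := by
  classical
  have hC : flipPos b k ∈ flips b := ⟨k, rfl⟩
  have h1 : (2 ^ Nat.log 2 (b (k + 1)) + j) * 2 ^ level b k =
      1 * 2 ^ flipPos b k + j * 2 ^ level b k := by
    rw [flipPos, pow_add]; ring
  have h2 : j * 2 ^ level b k < 2 ^ flipPos b k := by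
    rw [flipPos, add_comm, pow_add]
    exact Nat.mul_lt_mul_of_pos_right hj (by positivity)
  have h3 : key (flips b) (1 * 2 ^ flipPos b k) = ∅ := by
    rw [key, one_mul, bits_two_pow, Finset.filter_singleton, if_neg (not_not.2 hC)]
  have h4 : par (flips b) (1 * 2 ^ flipPos b k) = true := by
    rw [par, one_mul, bits_two_pow, Finset.filter_singleton, if_pos hC, Finset.card_singleton]
    rfl
  funext a
  rw [move, move, h1, key_mul_pow_add _ _ h2, par_mul_pow_add _ _ h2, h3, h4,
    ← Finset.bot_eq_empty, symmDiff_bot]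
  cases η (symmDiff a (key (flips b) (j * 2 ^ level b k))) <;>
    cases par (flips b) (j * 2 ^ level b k) <;> rfl

theorem initWord_level_succ (b : ℕ → ℕ) (k : ℕ) (η : Finset ℕ → Bool) :
    let us := (List.range (2 ^ Nat.log 2 (b (k + 1)))).map fun j =>
      initWord (flips b) (level b k) (move (flips b) (j * 2 ^ level b k) η)
    initWord (flips b) (level b (k + 1)) η = withGaps (us ++ us.map negWord) := by
  intro us
  have h1 : 2 ^ level b (k + 1) =
      (2 ^ Nat.log 2 (b (k + 1)) + 2 ^ Nat.log 2 (b (k + 1))) * 2 ^ level b k := by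
    rw [level_succ, flipPos]; ring
  rw [initWord, h1, ← withGaps_map_initWord, List.range_add, List.map_append]
  congr 2
  rw [List.map_map, List.map_map]
  refine List.map_congr_left fun j hj => ?_
  rw [Function.comp_apply, Function.comp_apply, negWord_initWord,
    move_add b k η (List.mem_range.1 hj)]

/-- The blocks of the first half of a word of the family number `k + 1` can be prescribed. -/
theorem exists_initWord_move_eq (b : ℕ → ℕ) (k : ℕ) (ηs : ℕ → Finset ℕ → Bool) :
    ∃ η, ∀ j < 2 ^ Nat.log 2 (b (k + 1)),
      initWord (flips b) (level b k) (move (flips b) (j * 2 ^ level b k) η) =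
        initWord (flips b) (level b k) (ηs j) := by
  classical
  obtain ⟨L, hL⟩ : ∃ L, L = level b k := ⟨_, rfl⟩
  rw [← hL]
  let f : ℕ → Finset ℕ := fun j => bits (j * 2 ^ L)
  have hf : Function.Injective f := fun i j hij =>
    Nat.eq_of_mul_eq_mul_right (by positivity : 0 < 2 ^ L) (bits_injective hij)
  -- The digits from `L` on in an index are those of the number of a block.
  refine ⟨fun a => ηs (Function.invFun f (a.filter (L ≤ ·))) (a.filter (· < L)), fun j hj => ?_⟩
  have hlt : j * 2 ^ L < 2 ^ flipPos b k := by
    rw [flipPos, ← hL, add_comm, pow_add]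
    exact Nat.mul_lt_mul_of_pos_right hj (by positivity)
  have hnot : ∀ i ∈ bits (j * 2 ^ L), i ∉ flips b := by
    rintro i hi ⟨m, rfl⟩
    have h1 := (mem_bits_mul_pow.1 hi).1
    have h2 := (flipPos_strictMono b).lt_iff_lt.1 (lt_of_mem_bits hlt hi)
    have h3 := (flipPos_lt_level_iff (b := b)).2 h2
    omega
  have hkey : key (flips b) (j * 2 ^ L) = f j := Finset.filter_true_of_mem hnot
  have hpar : par (flips b) (j * 2 ^ L) = false := by
    rw [par, Finset.filter_false_of_mem hnot]; rfl
  refine initWord_congr fun a ha => ?_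
  have hf' : ∀ i ∈ f j, L ≤ i := fun i hi => (mem_bits_mul_pow.1 hi).1
  have h1 : (symmDiff a (f j)).filter (L ≤ ·) = f j := by
    ext i
    rw [Finset.mem_filter, Finset.mem_symmDiff]
    constructor
    · rintro ⟨h | h, h'⟩
      · exact absurd (ha i h.1) (not_lt.2 h')
      · exact h.1
    · exact fun h => ⟨Or.inr ⟨h, fun h' => absurd (ha i h') (not_lt.2 (hf' i h))⟩, hf' i h⟩
  have h2 : (symmDiff a (f j)).filter (· < L) = a := by
    ext i
    rw [Finset.mem_filter, Finset.mem_symmDiff]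
    constructor
    · rintro ⟨h | h, h'⟩
      · exact h.1
      · exact absurd h' (not_lt.2 (hf' i h.1))
    · exact fun h => ⟨Or.inl ⟨h, fun h' => absurd (ha i h) (not_lt.2 (hf' i h'))⟩, ha i h⟩
  rw [move, hkey, hpar, Bool.xor_false, h1, h2, Function.leftInverse_invFun hf]

theorem blocks_eq_range {b : ℕ → ℕ} (hpow : ∀ n : ℕ, 1 ≤ n → ∃ j : ℕ, b n = 2 ^ j) (k : ℕ) :
    blocks b k = Set.range (initWord (flips b) (level b k)) := by
  induction k with
  | zero =>
    have h0 : ∀ η, initWord (flips b) (level b 0) η = [if η ∅ then 2 else 1] := fun η => by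
      have h1 : letterPos (2 ^ level b 0) = 1 := by simp [level, letterPos, omega]
      have h2 := point_letterPos (flips b) η 0
      have h3 : sign (flips b) η 0 = η ∅ := by simp [sign, key, par, bits]
      rw [h3] at h2
      rw [initWord, h1, ← h2]
      rfl
    ext w
    simp only [blocks, Set.mem_insert_iff, Set.mem_singleton_iff, Set.mem_range, h0]
    constructor
    · rintro (rfl | rfl)
      · exact ⟨fun _ => false, rfl⟩
      · exact ⟨fun _ => true, rfl⟩
    · rintro ⟨η, rfl⟩
      cases η ∅ <;> simp
  | succ k ih =>
    have hb := two_pow_log hpow (i := k + 1) (by omega)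
    ext w
    simp only [blocks, ih, Set.mem_ofPred_eq]
    constructor
    · rintro ⟨us, hlen, hus, rfl⟩
      have : ∀ j, ∃ η, ∀ h : j < us.length, us[j] = initWord (flips b) (level b k) η := fun j => by
        by_cases h : j < us.length
        · obtain ⟨η, hη⟩ := hus us[j] (List.getElem_mem h)
          exact ⟨η, fun _ => hη.symm⟩
        · exact ⟨fun _ => false, fun h' => absurd h' h⟩
      choose ηs hηs using this
      obtain ⟨η, hη⟩ := exists_initWord_move_eq b k ηs
      refine ⟨η, ?_⟩
      rw [initWord_level_succ]
      have hus' : us = (List.range (2 ^ Nat.log 2 (b (k + 1)))).map fun j =>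
          initWord (flips b) (level b k) (move (flips b) (j * 2 ^ level b k) η) := by
        refine List.ext_getElem (by simp [hb, hlen]) fun j h1 h2 => ?_
        rw [hηs j h1, ← hη j (by rw [hb, ← hlen]; exact h1)]
        simp
      rw [← hus']
    · rintro ⟨η, rfl⟩
      refine ⟨_, ?_, fun u hu => ?_, initWord_level_succ b k η⟩
      · simp [hb]
      · obtain ⟨j, -, rfl⟩ := List.mem_map.1 hu
        exact ⟨_, rfl⟩

theorem blockLength_eq {b : ℕ → ℕ} (hpow : ∀ n : ℕ, 1 ≤ n → ∃ j : ℕ, b n = 2 ^ j) (k : ℕ) :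
    blockLength b k = letterPos (2 ^ level b k) := by
  induction k with
  | zero => simp [blockLength, level, letterPos, omega]
  | succ k ih =>
    have h1 := letterPos_two_pow (level b (k + 1))
    have h2 := letterPos_two_pow (level b k)
    have hb := two_pow_log hpow (i := k + 1) (by omega)
    have h3 : 2 ^ (level b (k + 1) + 1) = 2 * b (k + 1) * 2 ^ (level b k + 1) := by
      conv_rhs => rw [← hb]
      rw [level_succ, flipPos]; ring
    rw [← h2, mul_add_one] at h3
    rw [blockLength, ih]
    omega

/-! ### The measure of the families -/

theorem isBlockMeasure_pointLaw {b : ℕ → ℕ} (hpow : ∀ n : ℕ, 1 ≤ n → ∃ j : ℕ, b n = 2 ^ j) :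
    IsBlockMeasure b (pointLaw (flips b)) := by
  intro k
  obtain ⟨L, hL⟩ : ∃ L, L = level b k := ⟨_, rfl⟩
  rw [blocks_eq_range hpow, blockLength_eq hpow, ← hL]
  set C := flips b
  have hval : ∀ u : List (Fin 3), u.length = letterPos (2 ^ L) →
      (pointLaw C : Measure Point) (wordCylinder u) =
        coins {η | initWord C L η = u} := fun u hu => by
    change coins.map (point C) _ = _
    rw [Measure.map_apply (measurable_point C)
      (measurableSet_of_dependsOn (dependsOn_wordCylinder u))]
    congr 1
    ext η
    rw [Set.mem_preimage, mem_wordCylinder_iff, hu]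
    rfl
  have hnot : ∀ u : List (Fin 3), u.length = letterPos (2 ^ L) → u ∉ Set.range (initWord C L) →
      (pointLaw C : Measure Point) (wordCylinder u) = 0 := fun u hu hur => by
    rw [hval u hu]
    have : {η | initWord C L η = u} = ∅ :=
      Set.eq_empty_of_forall_notMem fun η hη => hur ⟨η, hη⟩
    rw [this, measure_empty]
  have hmem : ∀ u ∈ Set.range (initWord C L), (pointLaw C : Measure Point) (wordCylinder u) =
      ENNReal.ofReal (2⁻¹ ^ (windowKeys C 0 (2 ^ L)).card) := by
    rintro u ⟨η₀, rfl⟩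
    rw [hval _ (by simp [initWord]), ← coins_matchSet (η₀ := η₀) (q := 0) (q₀ := 0) (R := L)
      (by simp), ofReal_measureReal]
    congr 1
    ext η
    simp only [Set.mem_ofPred_eq, matchSet, zero_mul, zero_add]
    constructor
    · intro h j hj
      have h1 : letterPos j < letterPos (2 ^ L) := letterPos_strictMono hj
      have h2 := List.map_inj_left.1 h (letterPos j) (List.mem_range.2 h1)
      exact point_letterPos_eq_iff.1 h2
    · intro h
      refine List.map_congr_left fun i hi => ?_
      by_cases hn : ∃ n, letterPos n = i
      · obtain ⟨n, rfl⟩ := hn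
        exact point_letterPos_eq_iff.2
          (h n (letterPos_strictMono.lt_iff_lt.1 (List.mem_range.1 hi)))
      · rw [not_exists] at hn
        rw [point_eq_zero hn, point_eq_zero hn]
  -- The words of the family have the same probability, and the sum of the probabilities is `1`.
  have hfin : (Set.range (initWord C L)).Finite :=
    (List.finite_length_eq (Fin 3) (letterPos (2 ^ L))).subset (by
      rintro u ⟨η, rfl⟩; simp [initWord])
  have hsum := measure_eq_sum_wordCylinder (pointLaw C : Measure Point) MeasurableSet.univ
    (letterPos (2 ^ L))
  simp only [measure_univ, Set.univ_inter] at hsum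
  rw [← Finset.sum_subset (s₁ := hfin.toFinset) (fun u hu => by
      obtain ⟨η, rfl⟩ := hfin.mem_toFinset.1 hu; simp [initWord])
    (fun u hu hur => hnot u (by simpa using hu) (by simpa using hur)),
    Finset.sum_congr rfl fun u hu => hmem u (hfin.mem_toFinset.1 hu), Finset.sum_const,
    nsmul_eq_mul, ← Set.ncard_eq_toFinset_card _ hfin] at hsum
  refine fun u hu => ⟨fun hur => ?_, hnot u hu⟩
  rw [hmem u hur, one_div]
  refine ENNReal.eq_inv_of_mul_eq_one_left ?_
  rw [mul_comm, ← hsum]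

theorem le_level (b : ℕ → ℕ) (k : ℕ) : k ≤ level b k := by
  induction k with
  | zero => exact Nat.zero_le _
  | succ k ih => rw [level_succ, flipPos]; omega

theorem eq_of_isBlockMeasure {b : ℕ → ℕ} (hpow : ∀ n : ℕ, 1 ≤ n → ∃ j : ℕ, b n = 2 ^ j)
    {ν₁ ν₂ : ProbabilityMeasure Point} (h₁ : IsBlockMeasure b ν₁) (h₂ : IsBlockMeasure b ν₂) :
    ν₁ = ν₂ := by
  refine Subtype.ext (measure_ext_of_dependsOn (μ₁ := (ν₁ : Measure Point)) fun n V hV => ?_)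
  have hV' := measurableSet_of_dependsOn hV
  have hn : n ≤ blockLength b n := by
    have h1 := letterPos_add_le 0 (2 ^ level b n)
    rw [zero_add] at h1
    have h2 := (level b n).lt_two_pow_self
    have h3 := le_level b n
    rw [blockLength_eq hpow]
    omega
  rw [measure_eq_sum_wordCylinder _ hV' (blockLength b n),
    measure_eq_sum_wordCylinder _ hV' (blockLength b n)]
  refine Finset.sum_congr rfl fun u hu => ?_
  have hu' : u.length = blockLength b n := by simpa using hu
  have hνu : (ν₁ : Measure Point) (wordCylinder u) = (ν₂ : Measure Point) (wordCylinder u) := by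
    by_cases hub : u ∈ blocks b n
    · rw [(h₁ n u hu').1 hub, (h₂ n u hu').1 hub]
    · rw [(h₁ n u hu').2 hub, (h₂ n u hu').2 hub]
  by_cases hne : ∃ y ∈ V, y ∈ wordCylinder u
  · obtain ⟨y, hyV, hyu⟩ := hne
    have : V ∩ wordCylinder u = wordCylinder u := Set.inter_eq_right.2 fun z hz =>
      (mem_iff_of_dependsOn hV fun j hj => by
        rw [hyu j (by omega), hz j (by omega)]).1 hyV
    rw [this]
    exact hνu
  · have : V ∩ wordCylinder u = ∅ :=
      Set.eq_empty_of_forall_notMem fun y hy => hne ⟨y, hy.1, hy.2⟩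
    rw [this, measure_empty]
    exact measure_empty.symm

end ExpReturn

end

theorem mainTheorem2 (b : ℕ → ℕ)
    (hpow : ∀ n : ℕ, 1 ≤ n → ∃ j : ℕ, b n = 2 ^ j)
    (hgrowth : Tendsto (fun n : ℕ => (b (n + 1) : ℝ) / 2 ^ (∏ i ∈ Finset.Icc 1 n, b i))
      atTop atTop) :
    (∃! ν : ProbabilityMeasure ExpReturn.Point, ExpReturn.IsBlockMeasure b ν) ∧
    ∀ ν : ProbabilityMeasure ExpReturn.Point, ExpReturn.IsBlockMeasure b ν →
      ∃ μ : ProbabilityMeasure ExpReturn.Point,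
        Tendsto (ExpReturn.cesaro ν) atTop (𝓝 μ) ∧
        MeasurePreserving ExpReturn.shift (μ : Measure ExpReturn.Point) μ ∧
        (μ : Measure ExpReturn.Point) (ExpReturn.goodPoints μ)ᶜ = 0 ∧
        ∀ x ∈ ExpReturn.goodPoints μ, ∀ t : ℝ, 0 < t →
          Tendsto (fun n : ℕ => ExpReturn.returnLaw μ (PiNat.cylinder x n) t)
            atTop (𝓝 (1 - Real.exp (-t))) ∧
          Tendsto (fun n : ℕ => ExpReturn.hittingLaw μ (PiNat.cylinder x n) t)
            atTop (𝓝 (1 - Real.exp (-t))) := by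
  have hν := ExpReturn.isBlockMeasure_pointLaw hpow
  refine ⟨⟨_, hν, fun ν hν' => ExpReturn.eq_of_isBlockMeasure hpow hν' hν⟩, fun ν hν' => ?_⟩
  rw [ExpReturn.eq_of_isBlockMeasure hpow hν' hν]
  obtain ⟨μ, hμ⟩ := ExpReturn.exists_tendsto_cesaro (ExpReturn.flips b)
  exact ⟨μ, hμ, ExpReturn.measurePreserving_shift_of_tendsto hμ,
    ExpReturn.measure_compl_goodPoints hμ, fun x hx t ht =>
      ExpReturn.tendsto_laws hpow hgrowth hμ hx ht⟩
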